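/- Let $M$ be a smooth manifold of dimension $n\ge 3$. Let $F\colon TM\to[0,\infty)$ be a Finsler metric, possibly singular along one direction in each tangent space: $F$ is continuous, $F(tv)=tF(v)$ for $t>0$, $F$ is of class $C^2$ on the complement of the zero section, every nonzero tangent vector at $x$ outside some line in $T_xM$ is regular, i.e. has a neighbourhood in $TM$ on which $F$ is $C^\infty$ (if $F$ is $C^\infty$ on the complement of the zero section, every nonzero vector is regular), and, with $E=\tfrac12F^2$, the Hessian $g_{ij}=\partial^2E/\partial y^i\partial y^j$ is positive definite at all nonzero vectors. In induced coordinates $(x,y)$ of $TM$ let $$G^l=\tfrac12 g^{lm}\Big(y^k\frac{\partial^2E}{\partial y^m\partial x^k}-\frac{\partial E}{\partial x^m}\Big),\qquad P^l_{ijk}=-\frac{\partial^3G^l}{\partial y^i\partial y^j\partial y^k}$$ (the mixed curvature of the Berwald connection). Let $\alpha\colon M\to\mathbb R$ be smooth with partial derivatives $\alpha_l$, let $p\in M$ with $d_p\alpha\ne0$, and let $\tilde P^l_{ijk}$ be the mixed curvature of $\tilde F=e^{\alpha}F$. Suppose that 1. the indicatrix $\{v\in T_pM: F(v)=1\}$,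 with the Riemannian metric induced by $g_{ij}$, has positive sectional curvature at its regular points; 2. $\tilde P^l_{ijk}\alpha_l=P^l_{ijk}\alpha_l$ at all regular tangent vectors of $M$. Then $p$ has an open neighbourhood $U$ such that at least one of the following holds: - $F=e^{\rho}F_0$ on $TU$, where $\rho$ is a smooth function on $U$ and $F_0$ is a Finsleroid-Finsler metric, that is, $$F_0=e^{G\Phi/2}\sqrt{b^2+gqb+q^2},\quad b=b_i(x)y^i,\quad q=\sqrt{a_{ij}(x)y^iy^j-b^2},\quad h=\sqrt{1-g^2/4},\quad G=g/h,$$ with a smooth Riemannian metric $a_{ij}$ on $U$, a smooth $1$-form $b_i$ on $U$ with $a^{ij}b_ib_j=1$, a smooth function $g=g(x)$ with $-2<g<2$, and $$\Phi=\pm\frac{\pi}{2}+\arctan\frac G2-\arctan\frac{q+\frac g2b}{hb}\quad\text{for } \pm b>0,\qquad \Phi=\arctan\frac G2\quad\text{for } b=0;$$ - $F$ is Riemannian on $U$, that is, $F(v)=\sqrt{a(v,v)}$ on $TU$ for a smooth Riemannian metric $a$ on $U$. -/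

import Mathlib

open scoped Manifold ContDiff Topology

noncomputable section

namespace FinslerConformal

/-- The coordinate space `ℝⁿ`. -/
abbrev Coord (n : ℕ) : Type := EuclideanSpace ℝ (Fin n)

/-- The `i`-th partial derivative of a real function on `ℝⁿ`. -/
def pd {n : ℕ} (i : Fin n) (f : Coord n → ℝ) (x : Coord n) : ℝ :=
  fderiv ℝ f x (EuclideanSpace.single i 1)

/-! ### Riemannian sectional curvature in coordinates -/

/-- Christoffel symbols `Γᵏᵢⱼ` of a Riemannian metric `h` given by its matrix in coordinates. -/
def christoffel {m : ℕ} (h : Coord m → Matrix (Fin m) (Fin m) ℝ) (k i j : Fin m)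
    (u : Coord m) : ℝ :=
  (1 / 2) * ∑ l, (h u)⁻¹ k l *
    (pd i (fun u' => h u' j l) u + pd j (fun u' => h u' i l) u - pd l (fun u' => h u' i j) u)

/-- Components of the curvature tensor: `R(∂ᵢ, ∂ⱼ)∂ₖ = Rˡₖᵢⱼ ∂ₗ`. -/
def riemannCurv {m : ℕ} (h : Coord m → Matrix (Fin m) (Fin m) ℝ) (l k i j : Fin m)
    (u : Coord m) : ℝ :=
  pd i (christoffel h l j k) u - pd j (christoffel h l i k) u
    + ∑ r, (christoffel h l i r u * christoffel h r j k u
      - christoffel h l j r u * christoffel h r i k u)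

/-- The value `h_u(a, b)`. -/
def metricVal {m : ℕ} (h : Coord m → Matrix (Fin m) (Fin m) ℝ) (u a b : Coord m) : ℝ :=
  ∑ i, ∑ j, h u i j * a i * b j

/-- The sectional curvature `h(R(a,b)b, a) / (h(a,a) h(b,b) - h(a,b)²)` of the plane spanned by
two linearly independent vectors `a, b` at `u`. -/
def sectionalCurv {m : ℕ} (h : Coord m → Matrix (Fin m) (Fin m) ℝ) (u a b : Coord m) : ℝ :=
  (∑ i, ∑ j, ∑ k, ∑ l, ∑ p, h u p l * riemannCurv h l k i j u * a i * b j * b k * a p) /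
    (metricVal h u a a * metricVal h u b b - metricVal h u a b ^ 2)

/-! ### Finsler quantities in induced coordinates `(x, y)` on the tangent bundle -/

/-- The energy `E = F² / 2`. -/
def energy {n : ℕ} (f : Coord n → Coord n → ℝ) (x y : Coord n) : ℝ := (1 / 2) * f x y ^ 2

/-- The Riemann-Finsler metric `gᵢⱼ = ∂²E / ∂yⁱ∂yʲ`. -/
def gMat {n : ℕ} (f : Coord n → Coord n → ℝ) (x y : Coord n) : Matrix (Fin n) (Fin n) ℝ :=
  Matrix.of fun i j => pd i (fun y' => pd j (fun y'' => energy f x y'') y') y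

/-- The geodesic spray coefficients
`Gˡ = (1/2) gˡᵐ (yᵏ ∂²E/∂yᵐ∂xᵏ - ∂E/∂xᵐ)`. -/
def spray {n : ℕ} (f : Coord n → Coord n → ℝ) (l : Fin n) (x y : Coord n) : ℝ :=
  (1 / 2) * ∑ m, (gMat f x y)⁻¹ l m *
    (∑ k, y k * pd m (fun y' => pd k (fun x' => energy f x' y') x) y
      - pd m (fun x' => energy f x' y) x)

/-- The mixed curvature of the Berwald connection
`Pˡᵢⱼₖ = - ∂³Gˡ / ∂yᵏ∂yʲ∂yⁱ`. -/
def berwaldP {n : ℕ} (f : Coord n → Coord n → ℝ) (l i j k : Fin n) (x y : Coord n) : ℝ :=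
  - pd k (fun y₁ => pd j (fun y₂ => pd i (fun y₃ => spray f l x y₃) y₂) y₁) y

/-! ### Finsler metrics on manifolds -/

section Manifold

variable {n : ℕ} {M : Type*} [TopologicalSpace M] [ChartedSpace (Coord n) M]

/-- The tangent vector `yⁱ ∂/∂uⁱ` at the point with coordinates `x` in the chart `e`. -/
def vec (e : OpenPartialHomeomorph M (Coord n)) (x y : Coord n) : TangentBundle (𝓡 n) M :=
  ⟨e.symm x, (mfderiv (𝓡 n) (𝓡 n) e.symm x : Coord n →L[ℝ] TangentSpace (𝓡 n) (e.symm x)) y⟩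

/-- The coordinate expression `F(x, y)` of a function on the tangent bundle. -/
def inChart (F : TangentBundle (𝓡 n) M → ℝ) (e : OpenPartialHomeomorph M (Coord n))
    (x y : Coord n) : ℝ :=
  F (vec e x y)

/-- The partial derivative `αₗ = ∂α/∂uˡ` in the chart `e`. -/
def partialAt (α : M → ℝ) (e : OpenPartialHomeomorph M (Coord n)) (l : Fin n) (x : Coord n) : ℝ :=
  pd l (fun x' => α (e.symm x')) x

/-- The conformal change `e^α F`. -/
def conformalChange (α : M → ℝ) (F : TangentBundle (𝓡 n) M → ℝ) :
    TangentBundle (𝓡 n) M → ℝ :=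
  fun v => Real.exp (α v.proj) * F v

variable [IsManifold (𝓡 n) ∞ M]

/-- A nonzero tangent vector is regular for `F` if `F` is smooth on a neighbourhood of it in the
tangent bundle. -/
def IsRegularVec (F : TangentBundle (𝓡 n) M → ℝ) (v : TangentBundle (𝓡 n) M) : Prop :=
  v.snd ≠ 0 ∧ ∀ᶠ w in 𝓝 v, ContMDiffAt (𝓡 n).tangent 𝓘(ℝ, ℝ) ∞ F w

/-- Finsler metrics, possibly singular along one direction in each tangent space: `F` is of class
`C²` off the zero section and smooth off the zero section and a line in each tangent space.
Metrics that are smooth on the whole complement of the zero section are the case in which every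
nonzero vector is regular. -/
structure IsFinsler (F : TangentBundle (𝓡 n) M → ℝ) : Prop where
  continuous : Continuous F
  nonneg : ∀ v, 0 ≤ F v
  contMDiffOn_two : ContMDiffOn (𝓡 n).tangent 𝓘(ℝ, ℝ) 2 F {v | v.snd ≠ 0}
  regular : ∀ x : M, ∃ d : TangentSpace (𝓡 n) x, ∀ v : TangentSpace (𝓡 n) x,
    v ∉ Submodule.span ℝ {d} → IsRegularVec F ⟨x, v⟩
  homogeneous : ∀ (x : M) (v : TangentSpace (𝓡 n) x) (t : ℝ), 0 < t →
    F ⟨x, t • v⟩ = t * F ⟨x, v⟩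
  posDef : ∀ e ∈ IsManifold.maximalAtlas (𝓡 n) ∞ M, ∀ x ∈ e.target, ∀ y : Coord n, y ≠ 0 →
    (gMat (inChart F e) x y).PosDef

/-- The Riemannian metric induced by `gᵢⱼ` on the indicatrix, in a local parametrization `φ`. -/
def inducedMetric {m : ℕ} (f : Coord n → Coord n → ℝ) (x : Coord n) (φ : Coord m → Coord n)
    (u : Coord m) : Matrix (Fin m) (Fin m) ℝ :=
  Matrix.of fun a b => ∑ i, ∑ j,
    gMat f x (φ u) i j * pd a (fun u' => φ u' i) u * pd b (fun u' => φ u' j) u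

/-- The indicatrix `{v ∈ TₚM | F v = 1}`, with the Riemannian metric induced by `gᵢⱼ`, has positive
sectional curvature (at its regular points): in every chart of `M` around `p` and every smooth
local parametrization of the regular part of the indicatrix, all sectional curvatures of the
induced metric are positive. -/
def IndicatrixPosCurvAt (F : TangentBundle (𝓡 n) M → ℝ) (p : M) : Prop :=
  ∀ e ∈ IsManifold.maximalAtlas (𝓡 n) ∞ M, p ∈ e.source →
    ∀ (W : Set (Coord (n - 1))) (φ : Coord (n - 1) → Coord n), IsOpen W → ContDiffOn ℝ ∞ φ W →
      (∀ u ∈ W, Function.Injective (fderiv ℝ φ u)) →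
      (∀ u ∈ W, inChart F e (e p) (φ u) = 1 ∧ IsRegularVec F (vec e (e p) (φ u))) →
      ∀ u ∈ W, ∀ a b : Coord (n - 1), LinearIndependent ℝ ![a, b] →
        0 < sectionalCurv (inducedMetric (inChart F e) (e p) φ) u a b

/-- `P̃ˡᵢⱼₖ αₗ = Pˡᵢⱼₖ αₗ` for the conformal change `F̃ = e^α F`, at all regular vectors and in all
charts. -/
def ContractedBerwaldInvariant (F : TangentBundle (𝓡 n) M → ℝ) (α : M → ℝ) : Prop :=
  ∀ e ∈ IsManifold.maximalAtlas (𝓡 n) ∞ M, ∀ x ∈ e.target, ∀ y : Coord n,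
    IsRegularVec F (vec e x y) → ∀ i j k : Fin n,
      ∑ l, berwaldP (inChart (conformalChange α F) e) l i j k x y * partialAt α e l x
        = ∑ l, berwaldP (inChart F e) l i j k x y * partialAt α e l x

/-- A smooth Riemannian metric on the open set `U`; smoothness is that of the function
`aᵢⱼ(x) yⁱ yʲ` on the tangent bundle of `U`. -/
structure IsRiemannianOn (U : Set M) (a : ∀ x : M, LinearMap.BilinForm ℝ (TangentSpace (𝓡 n) x)) :
    Prop where
  symm : ∀ x ∈ U, ∀ v w, a x v w = a x w v
  pos : ∀ x ∈ U, ∀ v, v ≠ 0 → 0 < a x v v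
  smooth : ContMDiffOn (𝓡 n).tangent 𝓘(ℝ, ℝ) ∞
    (fun v : TangentBundle (𝓡 n) M => a v.proj v.snd v.snd) {v | v.proj ∈ U}

/-- `F` is a Riemannian metric function on a neighbourhood of `p`. -/
def LocallyRiemannianAt (F : TangentBundle (𝓡 n) M → ℝ) (p : M) : Prop :=
  ∃ U : Set M, IsOpen U ∧ p ∈ U ∧ ∃ a : ∀ x : M, LinearMap.BilinForm ℝ (TangentSpace (𝓡 n) x),
    IsRiemannianOn U a ∧
    ∀ v : TangentBundle (𝓡 n) M, v.proj ∈ U → F v = Real.sqrt (a v.proj v.snd v.snd)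

/-- The angle `Φ` of the Finsleroid; at `b = 0` it is the common limit of the two branches. -/
def finsleroidAngle (g b q : ℝ) : ℝ :=
  let h := Real.sqrt (1 - g ^ 2 / 4)
  let G := g / h
  if 0 < b then Real.pi / 2 + Real.arctan (G / 2) - Real.arctan ((q + g / 2 * b) / (h * b))
  else if b < 0 then
    - (Real.pi / 2) + Real.arctan (G / 2) - Real.arctan ((q + g / 2 * b) / (h * b))
  else Real.arctan (G / 2)

/-- `e^{GΦ/2} √(b² + g q b + q²)` with `h = √(1 - g²/4)`, `G = g / h`. -/
def finsleroidFun (g b q : ℝ) : ℝ :=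
  Real.exp (g / Real.sqrt (1 - g ^ 2 / 4) * finsleroidAngle g b q / 2)
    * Real.sqrt (b ^ 2 + g * q * b + q ^ 2)

/-- `F₀` is over the open set `U` a Finsleroid-Finsler metric: it is built from a smooth
Riemannian metric `a`, a smooth 1-form `b` of unit length with respect to `a` (`w` is the vector
dual to `b`) and a smooth function `g` with values in `(-2, 2)`, with
`q = √(a(v,v) - b(v)²)`. -/
def IsFinsleroidOn (U : Set M) (F₀ : TangentBundle (𝓡 n) M → ℝ) : Prop :=
  ∃ (a : ∀ x : M, LinearMap.BilinForm ℝ (TangentSpace (𝓡 n) x))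
    (b : ∀ x : M, Module.Dual ℝ (TangentSpace (𝓡 n) x)) (g : M → ℝ),
    IsRiemannianOn U a ∧
    ContMDiffOn (𝓡 n).tangent 𝓘(ℝ, ℝ) ∞
      (fun v : TangentBundle (𝓡 n) M => b v.proj v.snd) {v | v.proj ∈ U} ∧
    (∀ x ∈ U, ∃ w : TangentSpace (𝓡 n) x, (∀ v, a x w v = b x v) ∧ b x w = 1) ∧
    ContMDiffOn (𝓡 n) 𝓘(ℝ, ℝ) ∞ g U ∧
    (∀ x ∈ U, -2 < g x ∧ g x < 2) ∧
    ∀ v : TangentBundle (𝓡 n) M, v.proj ∈ U →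
      F₀ v = finsleroidFun (g v.proj) (b v.proj v.snd)
        (Real.sqrt (a v.proj v.snd v.snd - b v.proj v.snd ^ 2))

/-- `F` is conformal to a Finsleroid-Finsler metric on a neighbourhood of `p`. -/
def LocallyConformalToFinsleroidAt (F : TangentBundle (𝓡 n) M → ℝ) (p : M) : Prop :=
  ∃ U : Set M, IsOpen U ∧ p ∈ U ∧ ∃ (ρ : M → ℝ) (F₀ : TangentBundle (𝓡 n) M → ℝ),
    ContMDiffOn (𝓡 n) 𝓘(ℝ, ℝ) ∞ ρ U ∧ IsFinsleroidOn U F₀ ∧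
    ∀ v : TangentBundle (𝓡 n) M, v.proj ∈ U → F v = conformalChange ρ F₀ v

end Manifold

end FinslerConformal

end

noncomputable section

namespace FinslerConformal

/-! ### The Finsleroid function of two variables -/

/-! Put `η = dα` at a point. Since `Ẽ = e^{2α} E`, the conformal change adds `(αₖyᵏ) yˡ - E gˡᵐ αₘ`
to the spray (`spray_exp_mul`). Contracted with `αₗ`, the invariance of the mixed curvature says
that all third `y`-derivatives of `(αₘyᵐ)² - ½F²|η|²`, with `|η|² = gˡᵐαₗαₘ`, vanish at regular
vectors. For `n ≥ 3` the complement of a line is connected and dense, so this 2-homogeneous function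
is a quadratic form, and hence so is `F²|η|² = A(y, y)` (`exists_matrixForm_eq`).

What remains at each point concerns a single Minkowski norm (`exists_eq_finsleroid`). Cauchy–Schwarz
for `g_y` gives `F² η(X)² ≤ A(y, y) g_y(X, X)`. Taking `X = y` gives `η² ≤ A`, with equality where
`η²/F²` is maximal. So `η` has `A`-norm one, and `A = η² + Q` with `Q ≥ 0` vanishing exactly on an
axis `ℝw`. The Finsleroid `e^ρ F₀(η, √Q)` satisfies the same equation off the axis, and `g`, `ρ` can
be fitted so that it agrees with `F` at `w` and `-w`.

Uniqueness comes from a maximum principle. The stretched Finsleroid `K`, with `μ√Q` in place of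
`√Q`, satisfies `K²|η|² = η² + μ²Q`. For `μ > 1`, a maximum of `F/K` off the axis would make `rK`
touch `F` from above; comparing Hessians there gives `F²|η|² ≥ η² + μ²Q > A`, which is absurd. So
the maximum lies on the axis, where `F = K`, and therefore `F ≤ K`. In the same way `K ≤ F` for `μ <
1`, and `μ → 1` gives equality. Second derivatives of `K` are needed only off the axis.

For smooth dependence on the base point, the coefficients of `A` are found by polarization near a
regular vector, and `g`, `ρ` from the value and the derivative along `w` of `F` at a regular vector
in `ker η` (`parameters_eq`). Charts carry the result to the manifold. -/

theorem arctan_add_arctan_of_mul_sub_one {T u c : ℝ} (hc : c < T) (hc' : c < u) (hpos : 0 < T + u)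
    (h : T * u - 1 = c * (T + u)) :
    Real.arctan T + Real.arctan u = Real.pi / 2 + Real.arctan c := by
  -- For `u > 0` the relation says that `T` is the tangent of `arctan c + arctan u⁻¹`. The
  -- hypotheses are symmetric in `T` and `u`, and one of the two is positive because their sum is.
  have key : ∀ {T u : ℝ}, c < u → 0 < u → T * u - 1 = c * (T + u) →
      Real.arctan T + Real.arctan u = Real.pi / 2 + Real.arctan c := by
    intro T u hcu hu h
    have h1 : c * u⁻¹ < 1 := by
      rw [← div_eq_mul_inv, div_lt_one hu]; exact hcu
    have h2 := Real.arctan_add h1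
    have h3 : (c + u⁻¹) / (1 - c * u⁻¹) = T := by
      have : u - c ≠ 0 := by linarith
      have h1' : 1 - c * u⁻¹ ≠ 0 := by linarith
      rw [div_eq_iff h1']
      field_simp
      linarith
    rw [h3, Real.arctan_inv_of_pos hu] at h2
    linarith
  rcases lt_or_ge 0 u with hu | hu
  · exact key hc' hu h
  · rw [add_comm]
    exact key hc (by linarith) (by linarith)

variable {g : ℝ}

theorem one_sub_sq_div_four_pos (hg : -2 < g ∧ g < 2) : 0 < 1 - g ^ 2 / 4 := by
  nlinarith [hg.1, hg.2]

theorem sqrt_one_sub_pos (hg : -2 < g ∧ g < 2) : 0 < √(1 - g ^ 2 / 4) :=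
  Real.sqrt_pos.2 (one_sub_sq_div_four_pos hg)

/-- For `q > 0` the branches `b > 0`, `b < 0` and `b = 0` are one arctangent of `b/q`, so the angle
is smooth across `b = 0`. The arguments `T`, `u` of the two arctangents satisfy `Tu - 1 = (G/2)(T +
u)` because `h² = 1 - g²/4`; for `b < 0` all signs are reversed. -/
theorem finsleroidAngle_of_pos (hg : -2 < g ∧ g < 2) (b : ℝ) {q : ℝ} (hq : 0 < q) :
    finsleroidAngle g b q = Real.arctan ((b / q + g / 2) / √(1 - g ^ 2 / 4)) := by
  have hh := sqrt_one_sub_pos hg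
  have hsq : √(1 - g ^ 2 / 4) ^ 2 = 1 - g ^ 2 / 4 := Real.sq_sqrt (one_sub_sq_div_four_pos hg).le
  simp only [finsleroidAngle]
  set h := √(1 - g ^ 2 / 4)
  have hpos : ∀ (b : ℝ), 0 < b ^ 2 + g * b * q + q ^ 2 := by
    intro b
    have : b ^ 2 + g * b * q + q ^ 2 = (b + g / 2 * q) ^ 2 + (1 - g ^ 2 / 4) * q ^ 2 := by ring
    rw [this]
    have := one_sub_sq_div_four_pos hg
    positivity
  split_ifs with h1 h2
  · have := arctan_add_arctan_of_mul_sub_one (T := (b / q + g / 2) / h)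
      (u := (q + g / 2 * b) / (h * b)) (c := g / h / 2) ?_ ?_ ?_ ?_
    · linarith
    · have : (b / q + g / 2) / h = g / h / 2 + b / (q * h) := by field_simp; ring
      have : 0 < b / (q * h) := by positivity
      linarith
    · have : (q + g / 2 * b) / (h * b) = g / h / 2 + q / (b * h) := by field_simp; ring
      have : 0 < q / (b * h) := by positivity
      linarith
    · have : (b / q + g / 2) / h + (q + g / 2 * b) / (h * b)
          = (b ^ 2 + g * b * q + q ^ 2) / (h * b * q) := by field_simp; ring
      rw [this]
      exact div_pos (hpos b) (by positivity)
    · field_simp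
      linear_combination (-4 * b * q) * hsq
  · have hb : b ≠ 0 := h2.ne
    have := arctan_add_arctan_of_mul_sub_one (T := -((b / q + g / 2) / h))
      (u := -((q + g / 2 * b) / (h * b))) (c := -(g / h / 2)) ?_ ?_ ?_ ?_
    · simp only [Real.arctan_neg] at this
      linarith
    · have : (b / q + g / 2) / h = g / h / 2 + b / (q * h) := by field_simp; ring
      have : b / (q * h) < 0 := div_neg_of_neg_of_pos h2 (by positivity)
      linarith
    · have : (q + g / 2 * b) / (h * b) = g / h / 2 + q / (b * h) := by field_simp; ring
      have : q / (b * h) < 0 := div_neg_of_pos_of_neg hq (mul_neg_of_neg_of_pos h2 hh)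
      linarith
    · have : -((b / q + g / 2) / h) + -((q + g / 2 * b) / (h * b))
          = (b ^ 2 + g * b * q + q ^ 2) / (h * (-b) * q) := by field_simp; ring
      rw [this]
      have : 0 < -b := by linarith
      exact div_pos (hpos b) (by positivity)
    · field_simp
      linear_combination (-4 * b * q) * hsq
  · have : b = 0 := by linarith
    subst this
    congr 1
    field_simp
    ring

theorem finsleroidAngle_zero_of_pos {b : ℝ} (hb : 0 < b) : finsleroidAngle g b 0 = Real.pi / 2 := by
  simp only [finsleroidAngle, hb, if_true]
  have : (0 + g / 2 * b) / (√(1 - g ^ 2 / 4) * b) = g / √(1 - g ^ 2 / 4) / 2 := by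
    rw [zero_add, mul_div_mul_right _ _ hb.ne', div_right_comm]
  rw [this]
  ring

theorem finsleroidAngle_zero_of_neg {b : ℝ} (hb : b < 0) :
    finsleroidAngle g b 0 = -(Real.pi / 2) := by
  simp only [finsleroidAngle, hb, not_lt.2 hb.le, if_true, if_false]
  have : (0 + g / 2 * b) / (√(1 - g ^ 2 / 4) * b) = g / √(1 - g ^ 2 / 4) / 2 := by
    rw [zero_add, mul_div_mul_right _ _ hb.ne, div_right_comm]
  rw [this]
  ring

theorem finsleroidAngle_smul {t : ℝ} (ht : 0 < t) (b q : ℝ) :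
    finsleroidAngle g (t * b) (t * q) = finsleroidAngle g b q := by
  have : (t * q + g / 2 * (t * b)) / (√(1 - g ^ 2 / 4) * (t * b))
      = (q + g / 2 * b) / (√(1 - g ^ 2 / 4) * b) := by
    rw [show t * q + g / 2 * (t * b) = t * (q + g / 2 * b) by ring,
      show √(1 - g ^ 2 / 4) * (t * b) = t * (√(1 - g ^ 2 / 4) * b) by ring,
      mul_div_mul_left _ _ ht.ne']
  have h1 : 0 < t * b ↔ 0 < b := mul_pos_iff_of_pos_left ht
  have h2 : t * b < 0 ↔ b < 0 := by
    constructor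
    · intro h; by_contra h'; nlinarith
    · intro h; nlinarith
  simp only [finsleroidAngle, this, h1, h2]

theorem finsleroidFun_smul {t : ℝ} (ht : 0 < t) (b q : ℝ) :
    finsleroidFun g (t * b) (t * q) = t * finsleroidFun g b q := by
  unfold finsleroidFun
  rw [finsleroidAngle_smul ht, show (t * b) ^ 2 + g * (t * q) * (t * b) + (t * q) ^ 2
    = t ^ 2 * (b ^ 2 + g * q * b + q ^ 2) by ring, Real.sqrt_mul (sq_nonneg t), Real.sqrt_sq ht.le]
  ring

theorem finsleroid_quadratic_pos (hg : -2 < g ∧ g < 2) {b q : ℝ} (h : b ≠ 0 ∨ q ≠ 0) :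
    0 < b ^ 2 + g * q * b + q ^ 2 := by
  have h1 := one_sub_sq_div_four_pos hg
  rcases h with h | h
  · have : b ^ 2 + g * q * b + q ^ 2 = (q + g / 2 * b) ^ 2 + (1 - g ^ 2 / 4) * b ^ 2 := by ring
    rw [this]
    positivity
  · have : b ^ 2 + g * q * b + q ^ 2 = (b + g / 2 * q) ^ 2 + (1 - g ^ 2 / 4) * q ^ 2 := by ring
    rw [this]
    positivity

theorem finsleroidFun_pos (hg : -2 < g ∧ g < 2) {b q : ℝ} (h : b ≠ 0 ∨ q ≠ 0) :
    0 < finsleroidFun g b q :=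
  mul_pos (Real.exp_pos _) (Real.sqrt_pos.2 (finsleroid_quadratic_pos hg h))

@[simp]
theorem finsleroidFun_zero_zero : finsleroidFun g 0 0 = 0 := by
  simp [finsleroidFun]

theorem finsleroidFun_zero_of_pos {b : ℝ} (hb : 0 < b) :
    finsleroidFun g b 0 = Real.exp (g / √(1 - g ^ 2 / 4) * Real.pi / 4) * b := by
  unfold finsleroidFun
  rw [finsleroidAngle_zero_of_pos hb]
  congr 1
  · congr 1; ring
  · simp [Real.sqrt_sq hb.le]

theorem finsleroidFun_zero_of_neg {b : ℝ} (hb : b < 0) :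
    finsleroidFun g b 0 = Real.exp (-(g / √(1 - g ^ 2 / 4) * Real.pi / 4)) * -b := by
  unfold finsleroidFun
  rw [finsleroidAngle_zero_of_neg hb]
  congr 1
  · congr 1; ring
  · simp [Real.sqrt_sq_eq_abs, abs_of_neg hb]

/-- Near `b = 0` the single arctangent formula for `q > 0` applies; elsewhere one of the original
branches holds nearby, and it stays continuous at `q = 0`. The poles of the axis are thus included,
as the compactness argument requires. -/
theorem continuousAt_finsleroidAngle (hg : -2 < g ∧ g < 2) {z : ℝ × ℝ} (hz : z.1 ≠ 0 ∨ 0 < z.2) :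
    ContinuousAt (fun z : ℝ × ℝ => finsleroidAngle g z.1 z.2) z := by
  have hh := sqrt_one_sub_pos hg
  by_cases hz1 : z.1 = 0
  · have hz2 : 0 < z.2 := hz.resolve_left (by simpa using hz1)
    have : (fun z : ℝ × ℝ => finsleroidAngle g z.1 z.2) =ᶠ[𝓝 z]
        fun z => Real.arctan ((z.1 / z.2 + g / 2) / √(1 - g ^ 2 / 4)) := by
      filter_upwards [continuous_snd.continuousAt.eventually (lt_mem_nhds hz2)] with y hy
      exact finsleroidAngle_of_pos hg _ hy
    refine ContinuousAt.congr ?_ this.symm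
    refine Real.continuous_arctan.continuousAt.comp ?_
    exact ((continuousAt_fst.div continuousAt_snd hz2.ne').add continuousAt_const).div_const _
  have hcont : ContinuousAt
      (fun z : ℝ × ℝ => Real.arctan ((z.2 + g / 2 * z.1) / (√(1 - g ^ 2 / 4) * z.1))) z := by
    refine Real.continuous_arctan.continuousAt.comp ?_
    refine ContinuousAt.div (by fun_prop) (by fun_prop) (by positivity)
  rcases lt_or_gt_of_ne hz1 with h | h
  · have : (fun z : ℝ × ℝ => finsleroidAngle g z.1 z.2) =ᶠ[𝓝 z]
        fun z => - (Real.pi / 2) + Real.arctan (g / √(1 - g ^ 2 / 4) / 2)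
          - Real.arctan ((z.2 + g / 2 * z.1) / (√(1 - g ^ 2 / 4) * z.1)) := by
      filter_upwards [continuous_fst.continuousAt.eventually (gt_mem_nhds h)] with y hy
      simp only [finsleroidAngle, hy, not_lt.2 hy.le, if_true, if_false]
    exact ContinuousAt.congr (continuousAt_const.sub hcont) this.symm
  · have : (fun z : ℝ × ℝ => finsleroidAngle g z.1 z.2) =ᶠ[𝓝 z]
        fun z => (Real.pi / 2) + Real.arctan (g / √(1 - g ^ 2 / 4) / 2)
          - Real.arctan ((z.2 + g / 2 * z.1) / (√(1 - g ^ 2 / 4) * z.1)) := by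
      filter_upwards [continuous_fst.continuousAt.eventually (lt_mem_nhds h)] with y hy
      simp only [finsleroidAngle, hy, if_true]
    exact ContinuousAt.congr (continuousAt_const.sub hcont) this.symm

theorem continuousAt_finsleroidFun (hg : -2 < g ∧ g < 2) {z : ℝ × ℝ} (hz : z.1 ≠ 0 ∨ 0 < z.2) :
    ContinuousAt (fun z : ℝ × ℝ => finsleroidFun g z.1 z.2) z := by
  unfold finsleroidFun
  have := continuousAt_finsleroidAngle hg hz
  refine ContinuousAt.mul ?_ (by fun_prop)
  exact Real.continuous_exp.continuousAt.comp
    ((continuousAt_const.mul this).div_const _)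

/-- The factor `F² / (b² + gqb + q²)` of the Finsleroid function, for `q > 0`. -/
def finsleroidFactor (g b q : ℝ) : ℝ :=
  Real.exp (g / √(1 - g ^ 2 / 4) * Real.arctan ((b / q + g / 2) / √(1 - g ^ 2 / 4)))

theorem finsleroidFactor_pos (g b q : ℝ) : 0 < finsleroidFactor g b q := Real.exp_pos _

theorem finsleroidFun_sq (hg : -2 < g ∧ g < 2) (b : ℝ) {q : ℝ} (hq : 0 < q) :
    finsleroidFun g b q ^ 2 = (b ^ 2 + g * q * b + q ^ 2) * finsleroidFactor g b q := by
  unfold finsleroidFun finsleroidFactor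
  rw [mul_pow, Real.sq_sqrt (finsleroid_quadratic_pos hg (Or.inr hq.ne')).le,
    finsleroidAngle_of_pos hg b hq, ← Real.exp_nat_mul, mul_comm]
  congr 2
  push_cast
  ring

/-- With `T` the argument of the arctangent, `1 + T² = (b² + gqb + q²)/(h²q²)`, so `h` cancels from
the logarithmic derivative. -/
theorem hasDerivAt_finsleroidFactor (hg : -2 < g ∧ g < 2) {b q : ℝ → ℝ} {b' q' t : ℝ}
    (hb : HasDerivAt b b' t) (hq : HasDerivAt q q' t) (hpos : 0 < q t) :
    HasDerivAt (fun t => finsleroidFactor g (b t) (q t))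
      (finsleroidFactor g (b t) (q t) * (g * (q t * b' - b t * q'))
        / (b t ^ 2 + g * q t * b t + q t ^ 2)) t := by
  have hh := sqrt_one_sub_pos hg
  have hsq : √(1 - g ^ 2 / 4) ^ 2 = 1 - g ^ 2 / 4 := Real.sq_sqrt (one_sub_sq_div_four_pos hg).le
  have hB := finsleroid_quadratic_pos hg (b := b t) (Or.inr hpos.ne')
  have := (((((hb.div hq hpos.ne').add_const (g / 2)).div_const (√(1 - g ^ 2 / 4))).arctan).const_mul
    (g / √(1 - g ^ 2 / 4))).exp
  refine this.congr_deriv ?_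
  simp only [Pi.div_apply]
  unfold finsleroidFactor
  rw [mul_div_assoc]
  congr 1
  set h := √(1 - g ^ 2 / 4)
  have e1 : 1 + ((b t / q t + g / 2) / h) ^ 2
      = (b t ^ 2 + g * q t * b t + q t ^ 2) / (h ^ 2 * q t ^ 2) := by
    field_simp
    linear_combination (4 * q t ^ 2) * hsq
  rw [e1]
  field_simp

/-- The first derivative of `½ F²` for the Finsleroid function along a curve with `q > 0`. -/
theorem hasDerivAt_half_finsleroidFun_sq (hg : -2 < g ∧ g < 2) {b q : ℝ → ℝ} {b' q' t : ℝ}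
    (hb : HasDerivAt b b' t) (hq : HasDerivAt q q' t) (hpos : 0 < q t) :
    HasDerivAt (fun t => 1 / 2 * finsleroidFun g (b t) (q t) ^ 2)
      (finsleroidFactor g (b t) (q t) * ((b t + g * q t) * b' + q t * q')) t := by
  have hB := finsleroid_quadratic_pos hg (b := b t) (Or.inr hpos.ne')
  have h1 : HasDerivAt (fun t => 1 / 2 * ((b t ^ 2 + g * q t * b t + q t ^ 2)
      * finsleroidFactor g (b t) (q t))) _ t :=
    (((((hb.pow 2).add ((hq.const_mul g).mul hb)).add (hq.pow 2)).mul
      (hasDerivAt_finsleroidFactor hg hb hq hpos)).const_mul (1 / 2))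
  have h2 : (fun t => 1 / 2 * finsleroidFun g (b t) (q t) ^ 2) =ᶠ[𝓝 t]
      fun t => 1 / 2 * ((b t ^ 2 + g * q t * b t + q t ^ 2)
      * finsleroidFactor g (b t) (q t)) := by
    filter_upwards [hq.continuousAt.eventually (lt_mem_nhds hpos)] with s hs
    rw [finsleroidFun_sq hg _ hs]
  refine (h1.congr_of_eventuallyEq h2).congr_deriv ?_
  simp only [Pi.add_apply, Pi.pow_apply, Pi.mul_apply]
  -- The derivative of the factor adds `g(q b' - b q')` to that of the quadratic form, and the terms
  -- in `b q'` cancel.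
  rw [mul_div_cancel₀ _ hB.ne']
  push_cast
  ring

/-- The second derivative of `½ F²` for the Finsleroid function along a line. -/
theorem exists_deriv_half_finsleroidFun_sq (hg : -2 < g ∧ g < 2) {b₀ β q₀ σ Z : ℝ} (hq : 0 < q₀) :
    ∃ e' : ℝ → ℝ, (∀ᶠ t in 𝓝 (0 : ℝ), HasDerivAt (fun t => 1 / 2 * finsleroidFun g (b₀ + t * β)
        (√(q₀ ^ 2 + 2 * t * σ + t ^ 2 * Z)) ^ 2) (e' t) t) ∧
      HasDerivAt e' (finsleroidFactor g b₀ q₀ / (b₀ ^ 2 + g * q₀ * b₀ + q₀ ^ 2) *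
        ((b₀ ^ 2 + q₀ ^ 2) * (σ / q₀ + g * q₀ ^ 2 * β / (b₀ ^ 2 + q₀ ^ 2)) ^ 2
          + (Z - (σ / q₀) ^ 2) * (b₀ ^ 2 + g * q₀ * b₀ + q₀ ^ 2)
          + (b₀ ^ 2 + g * q₀ * b₀ + q₀ ^ 2) ^ 2 * β ^ 2 / (b₀ ^ 2 + q₀ ^ 2))) 0 := by
  have hB := finsleroid_quadratic_pos hg (b := b₀) (Or.inr hq.ne')
  set Q : ℝ → ℝ := fun t => q₀ ^ 2 + 2 * t * σ + t ^ 2 * Z with hQ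
  have hQ' : ∀ t, HasDerivAt Q (2 * (σ + t * Z)) t := by
    intro t
    have := (((hasDerivAt_id t).const_mul 2).mul_const σ).const_add (q₀ ^ 2) |>.add
      (((hasDerivAt_id t).pow 2).mul_const Z)
    refine this.congr_deriv ?_
    simp; ring
  have hQ0 : Q 0 = q₀ ^ 2 := by simp [hQ]
  have hb' : ∀ t, HasDerivAt (fun t => b₀ + t * β) β t := by
    intro t
    simpa using ((hasDerivAt_id t).mul_const β).const_add b₀
  have hpos : ∀ᶠ t in 𝓝 (0 : ℝ), 0 < Q t := by
    refine (hQ' 0).continuousAt.eventually (lt_mem_nhds ?_)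
    rw [hQ0]; positivity
  have hq' : ∀ t, 0 < Q t → HasDerivAt (fun t => √(Q t)) ((σ + t * Z) / √(Q t)) t := by
    intro t ht
    refine ((hQ' t).sqrt ht.ne').congr_deriv ?_
    rw [mul_div_mul_left _ _ two_ne_zero]
  refine ⟨fun t => finsleroidFactor g (b₀ + t * β) (√(Q t)) *
    ((b₀ + t * β + g * √(Q t)) * β + (σ + t * Z)), ?_, ?_⟩
  · filter_upwards [hpos] with t ht
    refine (hasDerivAt_half_finsleroidFun_sq hg (hb' t) (hq' t ht)
      (Real.sqrt_pos.2 ht)).congr_deriv ?_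
    have := (Real.sqrt_pos.2 ht).ne'
    congr 2
    field_simp
  · have h0 : √(Q 0) = q₀ := by rw [hQ0, Real.sqrt_sq hq.le]
    have hp0 : 0 < Q 0 := hpos.self_of_nhds
    have h1 := hasDerivAt_finsleroidFactor hg (hb' 0) (hq' 0 hp0) (Real.sqrt_pos.2 hp0)
    have h2 : HasDerivAt (fun t => (b₀ + t * β + g * √(Q t)) * β + (σ + t * Z)) _ 0 :=
      (((hb' 0).add ((hq' 0 hp0).const_mul g)).mul_const β).add
        (((hasDerivAt_id (0 : ℝ)).mul_const Z).const_add σ)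
    refine (h1.mul h2).congr_deriv ?_
    have hbq : b₀ ^ 2 + q₀ ^ 2 ≠ 0 := by positivity
    simp only [h0, zero_mul, add_zero, one_mul]
    set B := b₀ ^ 2 + g * q₀ * b₀ + q₀ ^ 2 with hBdef
    field_simp
    rw [hBdef]
    ring

end FinslerConformal

namespace FinslerConformal

/-! ### Second order contact and homogeneous functions -/

/-- If `c < a`, the difference `ψ - φ` has a local minimum at `0` and a negative second derivative
there, hence also a local maximum. It is then constant near `0`, so its second derivative is zero.
Equality of the first derivatives is not assumed: it follows from the contact. -/
theorem second_deriv_le_of_contact {φ ψ φ' ψ' : ℝ → ℝ} {a c : ℝ}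
    (hφ : ∀ᶠ t in 𝓝 (0 : ℝ), HasDerivAt φ (φ' t) t) (hφ' : HasDerivAt φ' a 0)
    (hψ : ∀ᶠ t in 𝓝 (0 : ℝ), HasDerivAt ψ (ψ' t) t) (hψ' : HasDerivAt ψ' c 0)
    (hle : ∀ᶠ t in 𝓝 (0 : ℝ), φ t ≤ ψ t) (h0 : φ 0 = ψ 0) : a ≤ c := by
  by_contra! hlt
  set D : ℝ → ℝ := ψ - φ
  have hD : ∀ᶠ t in 𝓝 (0 : ℝ), HasDerivAt D ((ψ' - φ') t) t := by
    filter_upwards [hφ, hψ] with t h1 h2 using h2.sub h1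
  have hderiv : deriv D =ᶠ[𝓝 0] ψ' - φ' := by
    filter_upwards [hD] with t ht using ht.deriv
  have hdd : deriv (deriv D) 0 = c - a := by
    rw [hderiv.deriv_eq, (hψ'.sub hφ').deriv]
  have hmin : IsLocalMin D 0 := by
    filter_upwards [hle] with t ht
    simp only [D, Pi.sub_apply, h0, sub_self]
    linarith
  have hmax : IsLocalMax D 0 :=
    isLocalMax_of_deriv_deriv_neg (by rw [hdd]; linarith) hmin.deriv_eq_zero
      hD.self_of_nhds.continuousAt
  have hconst : D =ᶠ[𝓝 0] fun _ => D 0 := by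
    filter_upwards [hmin, hmax] with t h1 h2 using le_antisymm h2 h1
  have h3 : deriv D =ᶠ[𝓝 0] fun _ => 0 := by
    simpa using hconst.deriv
  have h4 : deriv (deriv D) 0 = 0 := by rw [h3.deriv_eq]; simp
  linarith

/-! ### Euler identities for 2-homogeneous functions, and restriction to lines. -/

section Homogeneous

variable {V : Type*} [NormedAddCommGroup V] [NormedSpace ℝ V] {φ : V → ℝ}

theorem fderiv_smul_of_homogeneous_two (hφ : ∀ y, y ≠ 0 → ∀ t : ℝ, 0 < t → φ (t • y) = t ^ 2 * φ y)
    {y : V} (hy : y ≠ 0) {t : ℝ} (ht : 0 < t) : fderiv ℝ φ (t • y) = t • fderiv ℝ φ y := by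
  have h1 : (fun z => φ (t • z)) =ᶠ[𝓝 y] (t ^ 2) • φ := by
    filter_upwards [isOpen_ne.mem_nhds hy] with z hz
    simpa using hφ z hz t ht
  have h2 := h1.fderiv_eq (𝕜 := ℝ)
  rw [fderiv_comp_smul, fderiv_const_smul_field, Pi.smul_apply, pow_two, mul_smul] at h2
  exact smul_right_injective _ ht.ne' h2

theorem fderiv_fderiv_smul_of_homogeneous_two
    (hφ : ∀ y, y ≠ 0 → ∀ t : ℝ, 0 < t → φ (t • y) = t ^ 2 * φ y)
    {y : V} (hy : y ≠ 0) {t : ℝ} (ht : 0 < t) :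
    fderiv ℝ (fderiv ℝ φ) (t • y) = fderiv ℝ (fderiv ℝ φ) y := by
  have h1 : (fun z => fderiv ℝ φ (t • z)) =ᶠ[𝓝 y] t • fderiv ℝ φ := by
    filter_upwards [isOpen_ne.mem_nhds hy] with z hz
    exact fderiv_smul_of_homogeneous_two hφ hz ht
  have h2 := h1.fderiv_eq (𝕜 := ℝ)
  have h3 : fderiv ℝ (t • fderiv ℝ φ) y = t • fderiv ℝ (fderiv ℝ φ) y :=
    congrFun (fderiv_const_smul_field (f := fderiv ℝ φ) t) y
  rw [fderiv_comp_smul, h3] at h2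
  exact smul_right_injective _ ht.ne' h2

theorem fderiv_apply_self_of_homogeneous_two
    (hφ : ∀ y, y ≠ 0 → ∀ t : ℝ, 0 < t → φ (t • y) = t ^ 2 * φ y)
    {y : V} (hy : y ≠ 0) (hd : DifferentiableAt ℝ φ y) : fderiv ℝ φ y y = 2 * φ y := by
  have h1 : HasDerivAt (fun t : ℝ => φ (t • y)) (fderiv ℝ φ y y) 1 := by
    have hd' : HasFDerivAt φ (fderiv ℝ φ y) ((1 : ℝ) • y) := by simpa using hd.hasFDerivAt
    exact (hd'.comp_hasDerivAt (1 : ℝ) ((hasDerivAt_id (1 : ℝ)).smul_const y)).congr_deriv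
      (by simp)
  have h2 : HasDerivAt (fun t : ℝ => t ^ 2 * φ y) (2 * φ y) 1 := by
    simpa using (hasDerivAt_pow 2 (1 : ℝ)).mul_const (φ y)
  refine h1.unique (h2.congr_of_eventuallyEq ?_)
  filter_upwards [lt_mem_nhds (zero_lt_one' ℝ)] with t ht using hφ y hy t ht

theorem fderiv_fderiv_apply_self_of_homogeneous_two
    (hφ : ∀ y, y ≠ 0 → ∀ t : ℝ, 0 < t → φ (t • y) = t ^ 2 * φ y)
    {y : V} (hy : y ≠ 0) (hd : DifferentiableAt ℝ (fderiv ℝ φ) y) :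
    fderiv ℝ (fderiv ℝ φ) y y = fderiv ℝ φ y := by
  have h1 : HasDerivAt (fun t : ℝ => fderiv ℝ φ (t • y)) (fderiv ℝ (fderiv ℝ φ) y y) 1 := by
    have hd' : HasFDerivAt (fderiv ℝ φ) (fderiv ℝ (fderiv ℝ φ) y) ((1 : ℝ) • y) := by
      simpa using hd.hasFDerivAt
    exact (hd'.comp_hasDerivAt (1 : ℝ) ((hasDerivAt_id (1 : ℝ)).smul_const y)).congr_deriv
      (by simp)
  have h2 : HasDerivAt (fun t : ℝ => t • fderiv ℝ φ y) (fderiv ℝ φ y) 1 := by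
    simpa using (hasDerivAt_id (1 : ℝ)).smul_const (fderiv ℝ φ y)
  refine h1.unique (h2.congr_of_eventuallyEq ?_)
  filter_upwards [lt_mem_nhds (zero_lt_one' ℝ)] with t ht
    using fderiv_smul_of_homogeneous_two hφ hy ht

theorem differentiableAt_fderiv_of_contDiffAt_two {y : V} (h : ContDiffAt ℝ 2 φ y) :
    DifferentiableAt ℝ (fderiv ℝ φ) y :=
  (h.fderiv_right (m := 1) (by norm_num)).differentiableAt (by norm_num)

theorem hasDerivAt_line (y X : V) (t : ℝ) : HasDerivAt (fun t : ℝ => y + t • X) X t := by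
  simpa using ((hasDerivAt_id t).smul_const X).const_add y

theorem tendsto_line (y X : V) : Filter.Tendsto (fun t : ℝ => y + t • X) (𝓝 0) (𝓝 y) := by
  simpa using (hasDerivAt_line y X 0).continuousAt.tendsto

theorem eventually_hasDerivAt_comp_line {y : V} (h : ContDiffAt ℝ 2 φ y) (X : V) :
    (∀ᶠ t in 𝓝 (0 : ℝ), HasDerivAt (fun t : ℝ => φ (y + t • X)) (fderiv ℝ φ (y + t • X) X) t) ∧
      HasDerivAt (fun t : ℝ => fderiv ℝ φ (y + t • X) X) (fderiv ℝ (fderiv ℝ φ) y X X) 0 := by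
  constructor
  · have h1 : ∀ᶠ z in 𝓝 y, DifferentiableAt ℝ φ z := by
      filter_upwards [h.eventually (by simp)] with z hz
      exact hz.differentiableAt (by norm_num)
    filter_upwards [(tendsto_line y X).eventually h1] with t ht
    exact ht.hasFDerivAt.comp_hasDerivAt t (hasDerivAt_line y X t)
  · have h1 : HasFDerivAt (fderiv ℝ φ) (fderiv ℝ (fderiv ℝ φ) y) (y + (0 : ℝ) • X) := by
      simpa using (differentiableAt_fderiv_of_contDiffAt_two h).hasFDerivAt
    have h2 := h1.comp_hasDerivAt (0 : ℝ) (hasDerivAt_line y X 0)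
    exact ((ContinuousLinearMap.apply ℝ ℝ X).hasFDerivAt.comp_hasDerivAt (0 : ℝ) h2)

end Homogeneous

end FinslerConformal

namespace FinslerConformal

/-! ### Minkowski norms with quadratic `F² |η|²` are Finsleroids -/

/-- `F` is a Minkowski norm and `η` a nonzero covector such that `F² g⁻¹(η, η)` is the quadratic
form of the symmetric bilinear form `A`, where `g` is the Hessian of `½ F²`. -/
structure HasQuadraticDualNorm {V : Type*} [NormedAddCommGroup V] [NormedSpace ℝ V] (F : V → ℝ)
    (η : V →L[ℝ] ℝ) (A : LinearMap.BilinForm ℝ V) : Prop where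
  nonneg : ∀ y, 0 ≤ F y
  homogeneous : ∀ (y : V) (t : ℝ), 0 < t → F (t • y) = t * F y
  contDiffAt : ∀ y, y ≠ 0 → ContDiffAt ℝ 2 F y
  posDef : ∀ y, y ≠ 0 → ∀ X, X ≠ 0 → 0 < fderiv ℝ (fderiv ℝ fun z => 1 / 2 * F z ^ 2) y X X
  ne_zero : η ≠ 0
  symm : ∀ v w, A v w = A w v
  quadratic : ∀ y, y ≠ 0 → ∃ W, (∀ X, fderiv ℝ (fderiv ℝ fun z => 1 / 2 * F z ^ 2) y W X = η X) ∧
    F y ^ 2 * η W = A y y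

namespace HasQuadraticDualNorm

variable {V : Type*} [NormedAddCommGroup V] [NormedSpace ℝ V] {F : V → ℝ}
  {η : V →L[ℝ] ℝ} {A : LinearMap.BilinForm ℝ V}

theorem contDiffAt_energy (H : HasQuadraticDualNorm F η A) {y : V} (hy : y ≠ 0) : ContDiffAt ℝ 2 (fun z => 1 / 2 * F z ^ 2) y :=
  contDiffAt_const.mul ((H.contDiffAt y hy).pow 2)

theorem energy_homogeneous (H : HasQuadraticDualNorm F η A) (y : V) (_ : y ≠ 0) (t : ℝ) (ht : 0 < t) :
    1 / 2 * F (t • y) ^ 2 = t ^ 2 * (1 / 2 * F y ^ 2) := by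
  rw [H.homogeneous y t ht]; ring

theorem hessian_symm (H : HasQuadraticDualNorm F η A) {y : V} (hy : y ≠ 0) (X Y : V) :
    fderiv ℝ (fderiv ℝ fun z => 1 / 2 * F z ^ 2) y X Y
      = fderiv ℝ (fderiv ℝ fun z => 1 / 2 * F z ^ 2) y Y X :=
  ((H.contDiffAt_energy hy).isSymmSndFDerivAt (by simp)).eq X Y

theorem hessian_self (H : HasQuadraticDualNorm F η A) {y : V} (hy : y ≠ 0) :
    fderiv ℝ (fderiv ℝ fun z => 1 / 2 * F z ^ 2) y y y = F y ^ 2 := by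
  rw [fderiv_fderiv_apply_self_of_homogeneous_two (φ := fun z => 1 / 2 * F z ^ 2)
    H.energy_homogeneous hy (differentiableAt_fderiv_of_contDiffAt_two (H.contDiffAt_energy hy)),
    fderiv_apply_self_of_homogeneous_two (φ := fun z => 1 / 2 * F z ^ 2) H.energy_homogeneous hy
    ((H.contDiffAt_energy hy).differentiableAt (by norm_num))]
  ring

theorem pos (H : HasQuadraticDualNorm F η A) {y : V} (hy : y ≠ 0) : 0 < F y := by
  have h := H.posDef y hy y hy
  rw [H.hessian_self hy] at h
  exact lt_of_le_of_ne (H.nonneg y) (by rintro h'; rw [← h'] at h; simp at h)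

theorem apply_zero (H : HasQuadraticDualNorm F η A) : F 0 = 0 := by
  have := H.homogeneous 0 2 (by norm_num)
  rw [smul_zero] at this
  linarith

theorem apply_dual_pos (H : HasQuadraticDualNorm F η A) {y : V} (hy : y ≠ 0) {W : V}
    (hW : ∀ X, fderiv ℝ (fderiv ℝ fun z => 1 / 2 * F z ^ 2) y W X = η X) : 0 < η W := by
  have hW0 : W ≠ 0 := by
    rintro rfl
    apply H.ne_zero
    ext X
    simp [← hW X]
  rw [← hW W]
  exact H.posDef y hy W hW0

theorem form_pos (H : HasQuadraticDualNorm F η A) {y : V} (hy : y ≠ 0) : 0 < A y y := by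
  obtain ⟨W, hW, hA⟩ := H.quadratic y hy
  rw [← hA]
  exact mul_pos (pow_pos (H.pos hy) 2) (H.apply_dual_pos hy hW)

/-- Cauchy–Schwarz for the Hessian `g_y` between `X` and the vector `W` dual to `η`, since `g_y(W,
W) = η W = A(y, y)/F²`. -/
theorem sq_mul_sq_le (H : HasQuadraticDualNorm F η A) {y : V} (hy : y ≠ 0) (X : V) :
    F y ^ 2 * η X ^ 2 ≤ A y y * fderiv ℝ (fderiv ℝ fun z => 1 / 2 * F z ^ 2) y X X := by
  obtain ⟨W, hW, hA⟩ := H.quadratic y hy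
  have hpos := H.apply_dual_pos hy hW
  set B := fderiv ℝ (fderiv ℝ fun z => 1 / 2 * F z ^ 2) y with hB
  have hXW : B X W = η X := by rw [hB, H.hessian_symm hy, ← hB, hW]
  have h0 : 0 ≤ B (η X • W - η W • X) (η X • W - η W • X) := by
    by_cases h : η X • W - η W • X = 0
    · simp [h]
    · exact (H.posDef y hy _ h).le
  have h1 : B (η X • W - η W • X) (η X • W - η W • X) = η W * (η W * B X X - η X ^ 2) := by
    simp only [map_sub, map_smul, sub_apply, smul_apply,
      smul_eq_mul, hW, hXW]
    ring
  rw [h1] at h0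
  have h2 : 0 ≤ η W * B X X - η X ^ 2 := by
    by_contra! h
    nlinarith
  rw [← hA]
  nlinarith [sq_nonneg (F y)]

/-- The case `X = y` of `sq_mul_sq_le`, where `g_y(y, y) = F²`; it says that `η` has `A`-norm at
most one. -/
theorem sq_le_form (H : HasQuadraticDualNorm F η A) (y : V) : η y ^ 2 ≤ A y y := by
  by_cases hy : y = 0
  · simp [hy]
  have h := H.sq_mul_sq_le hy y
  rw [H.hessian_self hy, mul_comm (A y y)] at h
  exact le_of_mul_le_mul_left h (pow_pos (H.pos hy) 2)

/-- At a maximum of `η²/F²` on the unit sphere the differentials of `η²` and `F²` are proportional.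
As `d(½F²) = g_y(y, ·)`, the vector dual to `η` is then a multiple of `y`, which is the equality
case of Cauchy–Schwarz. -/
theorem exists_form_eq_sq [FiniteDimensional ℝ V] (H : HasQuadraticDualNorm F η A) : ∃ y, η y ≠ 0 ∧ A y y = η y ^ 2 := by
  obtain ⟨v, hv⟩ : ∃ v, η v ≠ 0 := by
    by_contra! h
    exact H.ne_zero (by ext X; simp [h X])
  have hv0 : v ≠ 0 := by rintro rfl; simp at hv
  have : ProperSpace V := FiniteDimensional.proper ℝ V
  have hne : ∀ y ∈ Metric.sphere (0 : V) 1, y ≠ 0 := fun y hy => ne_zero_of_mem_unit_sphere ⟨y, hy⟩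
  have hcont : ContinuousOn (fun y => η y ^ 2 / F y ^ 2) (Metric.sphere (0 : V) 1) := by
    intro y hy
    have := (H.contDiffAt y (hne y hy)).continuousAt
    exact (ContinuousAt.div (by fun_prop) (this.pow 2)
      (pow_pos (H.pos (hne y hy)) 2).ne').continuousWithinAt
  have hunit : ∀ y : V, y ≠ 0 → ‖y‖⁻¹ • y ∈ Metric.sphere (0 : V) 1 := by
    intro y hy
    simp [norm_smul, hy]
  obtain ⟨y₀, hy₀, hmax⟩ := (isCompact_sphere (0 : V) 1).exists_isMaxOn ⟨_, hunit v hv0⟩ hcont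
  set c := η y₀ ^ 2 / F y₀ ^ 2 with hc
  have h₀ := hne y₀ hy₀
  have hle : ∀ y, y ≠ 0 → η y ^ 2 ≤ c * F y ^ 2 := by
    intro y hy
    have h1 : η (‖y‖⁻¹ • y) ^ 2 / F (‖y‖⁻¹ • y) ^ 2 ≤ c := hmax (hunit y hy)
    have hn : 0 < ‖y‖⁻¹ := by positivity
    rw [H.homogeneous y _ hn, map_smul, smul_eq_mul, mul_pow, mul_pow,
      mul_div_mul_left _ _ (pow_pos hn 2).ne', div_le_iff₀ (pow_pos (H.pos hy) 2)] at h1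
    exact h1
  have heq : η y₀ ^ 2 = c * F y₀ ^ 2 := by
    rw [hc, div_mul_cancel₀ _ (pow_pos (H.pos h₀) 2).ne']
  have hcpos : 0 < c := by
    by_contra! h
    have := hle v hv0
    have h2 : 0 < η v ^ 2 := by positivity
    nlinarith [sq_nonneg (F v)]
  have hη₀ : η y₀ ≠ 0 := by
    intro h
    rw [h] at heq
    have := pow_pos (H.pos h₀) 2
    nlinarith
  refine ⟨y₀, hη₀, ?_⟩
  have hmin : IsLocalMin (fun y => (2 * c) * (1 / 2 * F y ^ 2) - η y ^ 2) y₀ := by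
    filter_upwards [isOpen_ne.mem_nhds h₀] with y hy
    have := hle y hy
    linarith
  have hdiff := (H.contDiffAt_energy h₀).differentiableAt (by norm_num)
  have hd := ((hdiff.hasFDerivAt.const_mul (2 * c)).sub (η.hasFDerivAt.pow 2))
  have hzero := hmin.hasFDerivAt_eq_zero hd
  have hgrad : ∀ X, c * fderiv ℝ (fun z => 1 / 2 * F z ^ 2) y₀ X = η y₀ * η X := by
    intro X
    have := congrArg (fun L : V →L[ℝ] ℝ => L X) hzero
    simp at this
    simp
    linarith
  obtain ⟨W, hW, hA⟩ := H.quadratic y₀ h₀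
  -- Both vectors represent `η` through the Hessian, which is definite.
  have hWy : W = (c / η y₀) • y₀ := by
    by_contra h
    have h1 := H.posDef y₀ h₀ _ (sub_ne_zero.2 h)
    have h5 : ∀ Y, fderiv ℝ (fderiv ℝ fun z => 1 / 2 * F z ^ 2) y₀ (W - (c / η y₀) • y₀) Y
        = η Y - c / η y₀ * fderiv ℝ (fun z => 1 / 2 * F z ^ 2) y₀ Y := by
      intro Y
      rw [map_sub, map_smul, fderiv_fderiv_apply_self_of_homogeneous_two
        (φ := fun z => 1 / 2 * F z ^ 2) H.energy_homogeneous h₀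
        (differentiableAt_fderiv_of_contDiffAt_two (H.contDiffAt_energy h₀)),
        sub_apply, hW, smul_apply, smul_eq_mul]
    rw [h5] at h1
    have h2 := hgrad (W - (c / η y₀) • y₀)
    have h3 : c / η y₀ * fderiv ℝ (fun z => 1 / 2 * F z ^ 2) y₀ (W - (c / η y₀) • y₀)
        = η (W - (c / η y₀) • y₀) := by
      rw [div_mul_eq_mul_div, h2, mul_div_cancel_left₀ _ hη₀]
    linarith
  rw [← hA, hWy, map_smul, smul_eq_mul, div_mul_cancel₀ _ hη₀, heq, mul_comm]

/-- The form `A - η²` is nonnegative and vanishes at the normalized maximizer `w`, so `w` lies in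
its kernel: `A(w, ·) = η(w) η = η`. -/
theorem exists_dual_vector [FiniteDimensional ℝ V] (H : HasQuadraticDualNorm F η A) : ∃ w, (∀ v, A w v = η v) ∧ η w = 1 := by
  obtain ⟨y, hy, hA⟩ := H.exists_form_eq_sq
  have h1 : η ((η y)⁻¹ • y) = 1 := by simp [hy]
  refine ⟨(η y)⁻¹ • y, fun v => ?_, h1⟩
  set w := (η y)⁻¹ • y with hw
  have hww : A w w = 1 := by
    simp only [hw, map_smul, LinearMap.smul_apply, smul_eq_mul, hA]
    field_simp
  set k := A w v - η v with hk
  set Q := A v v - η v ^ 2 with hQ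
  have hQ0 : 0 ≤ Q := sub_nonneg.2 (H.sq_le_form v)
  have h2 : ∀ s : ℝ, 0 ≤ 2 * s * k + s ^ 2 * Q := by
    intro s
    have := H.sq_le_form (w + s • v)
    simp only [map_add, map_smul, LinearMap.add_apply, LinearMap.smul_apply, smul_eq_mul, hww, h1,
      H.symm v w] at this
    rw [hk, hQ]
    linarith
  -- Nearly the minimizer `-k/Q` of the quadratic polynomial; the `+ 1` covers the case `Q = 0`.
  have h3 := h2 (-k / (Q + 1))
  have h4 : 2 * (-k / (Q + 1)) * k + (-k / (Q + 1)) ^ 2 * Q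
      = -(k ^ 2 * (Q + 2) / (Q + 1) ^ 2) := by
    field_simp; ring
  rw [h4] at h3
  by_contra hne
  have hk0 : k ≠ 0 := fun h => hne (by linarith)
  have : 0 < k ^ 2 * (Q + 2) / (Q + 1) ^ 2 := by positivity
  linarith

/-- The form `A` takes the value `A(y, y) - (η y)²` at `y - (η y) w`, and `A` is definite. -/
theorem eq_smul_of_form_eq_sq (H : HasQuadraticDualNorm F η A) {w : V} (hw : ∀ v, A w v = η v) (hw1 : η w = 1) {y : V}
    (hy : A y y - η y ^ 2 = 0) : y = η y • w := by
  by_contra h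
  have h1 := H.form_pos (sub_ne_zero.2 h)
  simp only [map_sub, map_smul, LinearMap.sub_apply, LinearMap.smul_apply, smul_eq_mul,
    H.symm y w, hw, hw1] at h1
  linarith

end HasQuadraticDualNorm

end FinslerConformal

/-! ### Stretched Finsleroids and the comparison with `F`. -/

namespace FinslerConformal

/-- The Finsleroid norm of the bilinear form `A` and the covector `η`, scaled by `e^ρ` and
stretched by `μ` in the directions orthogonal to the axis. -/
def stretchedFinsleroid {V : Type*} [NormedAddCommGroup V] [NormedSpace ℝ V] (g ρ μ : ℝ)
    (η : V →L[ℝ] ℝ) (A : LinearMap.BilinForm ℝ V) (y : V) : ℝ :=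
  Real.exp ρ * finsleroidFun g (η y) (μ * √(A y y - η y ^ 2))

namespace HasQuadraticDualNorm

variable {V : Type*} [NormedAddCommGroup V] [NormedSpace ℝ V] {F : V → ℝ}
  {η : V →L[ℝ] ℝ} {A : LinearMap.BilinForm ℝ V} {g ρ μ : ℝ}

theorem stretchedFinsleroid_smul (y : V) {t : ℝ} (ht : 0 < t) :
    stretchedFinsleroid g ρ μ η A (t • y) = t * stretchedFinsleroid g ρ μ η A y := by
  unfold stretchedFinsleroid
  have : A (t • y) (t • y) - η (t • y) ^ 2 = t ^ 2 * (A y y - η y ^ 2) := by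
    simp only [map_smul, LinearMap.smul_apply, smul_eq_mul]; ring
  rw [this, Real.sqrt_mul (sq_nonneg t), Real.sqrt_sq ht.le, map_smul, smul_eq_mul,
    mul_left_comm μ t, finsleroidFun_smul ht]
  ring

theorem ne_or_sqrt_pos (H : HasQuadraticDualNorm F η A) (hμ : 0 < μ) {y : V} (hy : y ≠ 0) :
    η y ≠ 0 ∨ 0 < μ * √(A y y - η y ^ 2) := by
  by_cases h : η y = 0
  · right
    have := H.form_pos hy
    rw [h]
    have : 0 < √(A y y - 0 ^ 2) := Real.sqrt_pos.2 (by simpa using this)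
    positivity
  · exact Or.inl h

theorem stretchedFinsleroid_pos (H : HasQuadraticDualNorm F η A) (hg : -2 < g ∧ g < 2)
    (hμ : 0 < μ) {y : V} (hy : y ≠ 0) : 0 < stretchedFinsleroid g ρ μ η A y :=
  mul_pos (Real.exp_pos _)
    (finsleroidFun_pos hg ((H.ne_or_sqrt_pos hμ hy).imp_right fun h => h.ne'))

theorem continuousAt_stretchedFinsleroid [FiniteDimensional ℝ V] (H : HasQuadraticDualNorm F η A)
    (hg : -2 < g ∧ g < 2) (hμ : 0 < μ) {y : V} (hy : y ≠ 0) :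
    ContinuousAt (stretchedFinsleroid g ρ μ η A) y := by
  have hA : Continuous fun y => A y y := by
    have h : Continuous fun y => LinearMap.toContinuousLinearMap (A y) y :=
      ((LinearMap.toContinuousLinearMap (𝕜 := ℝ) (E := V) (F' := ℝ)).toLinearMap ∘ₗ
        A).continuous_of_finiteDimensional.clm_apply continuous_id
    exact h
  refine continuousAt_const.mul ?_
  refine ContinuousAt.comp (f := fun y => (η y, μ * √(A y y - η y ^ 2)))
    (continuousAt_finsleroidFun hg (H.ne_or_sqrt_pos hμ hy)) ?_
  exact (η.continuous.prodMk (continuous_const.mul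
    (hA.sub (η.continuous.pow 2)).sqrt)).continuousAt

/-- The axis consists of the origin and the two rays through `w` and `-w`. Homogeneity is only
positive, so agreement is required at both poles. -/
theorem eq_stretchedFinsleroid_of_form_eq_sq (H : HasQuadraticDualNorm F η A) {w : V}
    (hw : ∀ v, A w v = η v) (hw1 : η w = 1) (h₁ : F w = stretchedFinsleroid g ρ μ η A w)
    (h₂ : F (-w) = stretchedFinsleroid g ρ μ η A (-w)) {y : V} (hy0 : y ≠ 0)
    (hy : A y y - η y ^ 2 = 0) : F y = stretchedFinsleroid g ρ μ η A y := by
  have hyw := H.eq_smul_of_form_eq_sq hw hw1 hy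
  rcases lt_trichotomy (η y) 0 with h | h | h
  · have : y = (-η y) • (-w) := by rw [smul_neg, neg_smul, neg_neg]; exact hyw
    rw [this, H.homogeneous _ _ (by linarith), stretchedFinsleroid_smul _ (by linarith), h₂]
  · rw [h, zero_smul] at hyw; exact absurd hyw hy0
  · rw [hyw, H.homogeneous _ _ h, stretchedFinsleroid_smul _ h, h₁]

/-- The Hessian of `½K²` is written so that `η(X)` is separated: the first term is a square, the
second is nonnegative by Cauchy–Schwarz for `A - η²`, and the third is `K² η(X)²/(η² + q²)`. The
first two can be made to vanish while `η(X) = 1`, which is why `K²|η|² = η² + q²`. -/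
theorem exists_deriv_stretchedFinsleroid (H : HasQuadraticDualNorm F η A) (hg : -2 < g ∧ g < 2)
    (hμ : 0 < μ) {y : V} {q : ℝ} (hq : q = μ * √(A y y - η y ^ 2)) (hqpos : 0 < q) (X : V)
    {σ Z : ℝ} (hσ : σ = μ ^ 2 * (A y X - η y * η X)) (hZ : Z = μ ^ 2 * (A X X - η X ^ 2)) :
    ∃ e' : ℝ → ℝ, (∀ᶠ t in 𝓝 (0 : ℝ), HasDerivAt
        (fun t : ℝ => 1 / 2 * stretchedFinsleroid g ρ μ η A (y + t • X) ^ 2) (e' t) t) ∧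
      HasDerivAt e' (Real.exp ρ ^ 2 *
        (finsleroidFactor g (η y) q / (η y ^ 2 + g * q * η y + q ^ 2) *
        ((η y ^ 2 + q ^ 2) * (σ / q + g * q ^ 2 * η X / (η y ^ 2 + q ^ 2)) ^ 2
          + (Z - (σ / q) ^ 2) * (η y ^ 2 + g * q * η y + q ^ 2)
          + (η y ^ 2 + g * q * η y + q ^ 2) ^ 2 * η X ^ 2 / (η y ^ 2 + q ^ 2)))) 0 := by
  obtain ⟨e', h1, h2⟩ := exists_deriv_half_finsleroidFun_sq hg (b₀ := η y) (β := η X) (σ := σ)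
    (Z := Z) hqpos
  refine ⟨fun t => Real.exp ρ ^ 2 * e' t, ?_, h2.const_mul _⟩
  filter_upwards [h1] with t ht
  refine (ht.const_mul (Real.exp ρ ^ 2)).congr_of_eventuallyEq (Filter.Eventually.of_forall ?_)
  intro s
  have e1 : μ * √(A (y + s • X) (y + s • X) - η (y + s • X) ^ 2)
      = √(q ^ 2 + 2 * s * σ + s ^ 2 * Z) := by
    nth_rw 1 [← Real.sqrt_sq hμ.le]
    rw [← Real.sqrt_mul (sq_nonneg _)]
    congr 1
    have h0 : 0 ≤ A y y - η y ^ 2 := sub_nonneg.2 (H.sq_le_form y)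
    rw [hq, mul_pow, Real.sq_sqrt h0, hσ, hZ]
    simp only [map_add, map_smul, LinearMap.add_apply, LinearMap.smul_apply, smul_eq_mul,
      H.symm X y]
    ring
  simp only [stretchedFinsleroid]
  rw [e1, map_add, map_smul, smul_eq_mul]
  ring

theorem exists_line_second_deriv (H : HasQuadraticDualNorm F η A) {y : V} (hy : y ≠ 0) (X : V) :
    ∃ e' : ℝ → ℝ, (∀ᶠ t in 𝓝 (0 : ℝ), HasDerivAt
        (fun t : ℝ => 1 / 2 * F (y + t • X) ^ 2) (e' t) t) ∧
      HasDerivAt e' (fderiv ℝ (fderiv ℝ fun z => 1 / 2 * F z ^ 2) y X X) 0 :=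
  ⟨_, eventually_hasDerivAt_comp_line (φ := fun z => 1 / 2 * F z ^ 2) (H.contDiffAt_energy hy) X⟩

/-- At a point off the axis, `F ≤ r K` cannot be an equality if `K` is stretched by `μ > 1`. -/
theorem not_contact_of_le (H : HasQuadraticDualNorm F η A) (hg : -2 < g ∧ g < 2) {w : V}
    (hw : ∀ v, A w v = η v) (hw1 : η w = 1) (hμ : 1 < μ) {r : ℝ} (hr : 0 < r)
    (hle : ∀ y, y ≠ 0 → F y ≤ r * stretchedFinsleroid g ρ μ η A y) {y : V} (hy : y ≠ 0)
    (heq : F y = r * stretchedFinsleroid g ρ μ η A y) : A y y - η y ^ 2 = 0 := by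
  have hμ0 : 0 < μ := by linarith
  by_contra hne
  have hQ : 0 < A y y - η y ^ 2 := lt_of_le_of_ne (sub_nonneg.2 (H.sq_le_form y)) (Ne.symm hne)
  set q₀ := √(A y y - η y ^ 2) with hq₀
  have hq₀pos : 0 < q₀ := Real.sqrt_pos.2 hQ
  have hq₀sq : q₀ ^ 2 = A y y - η y ^ 2 := Real.sq_sqrt hQ.le
  obtain ⟨q, hq⟩ : ∃ q, q = μ * q₀ := ⟨_, rfl⟩
  have hqpos : 0 < q := by rw [hq]; positivity
  -- With this `s` the vector `X` minimizes the Hessian of `½K²` among vectors with `η X = 1`: the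
  -- first square vanishes by the choice of `s`, and the transverse term because `X` lies in the
  -- span of `w` and `y`.
  obtain ⟨s, hs⟩ : ∃ s, s = -(g * q) / (η y ^ 2 + q ^ 2) := ⟨_, rfl⟩
  set X := w + s • (y - η y • w) with hX
  have hηX : η X = 1 := by
    simp only [hX, map_add, map_smul, map_sub, smul_eq_mul, hw1]; ring
  have hyX : A y X - η y * η X = s * q₀ ^ 2 := by
    rw [hηX, hX, hq₀sq]
    simp only [map_add, map_smul, map_sub, smul_eq_mul, H.symm y w, hw]
    ring
  have hXX : A X X - η X ^ 2 = s ^ 2 * q₀ ^ 2 := by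
    rw [hηX, hX, hq₀sq]
    simp only [map_add, map_smul, map_sub, LinearMap.add_apply, LinearMap.smul_apply,
      LinearMap.sub_apply, smul_eq_mul, H.symm y w, hw, hw1]
    ring
  obtain ⟨e', he, he'⟩ := H.exists_deriv_stretchedFinsleroid (ρ := ρ) hg hμ0 hq hqpos X rfl rfl
  obtain ⟨f', hf, hf'⟩ := H.exists_line_second_deriv hy X
  have hnear : ∀ᶠ t in 𝓝 (0 : ℝ), y + t • X ≠ 0 :=
    (tendsto_line y X).eventually (isOpen_ne.mem_nhds hy)
  have hB := finsleroid_quadratic_pos hg (b := η y) (Or.inr hqpos.ne')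
  have hcomp := second_deriv_le_of_contact hf hf'
    (ψ := fun t => r ^ 2 * (1 / 2 * stretchedFinsleroid g ρ μ η A (y + t • X) ^ 2))
    (ψ' := fun t => r ^ 2 * e' t)
    (by filter_upwards [he] with t ht using ht.const_mul _) (he'.const_mul _)
    (by
      filter_upwards [hnear] with t ht
      have h1 := hle _ ht
      have h2 := H.nonneg (y + t • X)
      have h3 := pow_le_pow_left₀ h2 h1 2
      rw [mul_pow] at h3
      linarith)
    (by simp only [zero_smul, add_zero, heq]; ring)
  have hK : stretchedFinsleroid g ρ μ η A y ^ 2 = Real.exp ρ ^ 2 *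
      ((η y ^ 2 + g * q * η y + q ^ 2) * finsleroidFactor g (η y) q) := by
    unfold stretchedFinsleroid
    rw [← hq₀, ← hq, mul_pow, finsleroidFun_sq hg _ hqpos]
  have hF : F y ^ 2 = r ^ 2 * stretchedFinsleroid g ρ μ η A y ^ 2 := by rw [heq, mul_pow]
  have hbq : 0 < η y ^ 2 + q ^ 2 := by positivity
  -- At the contact the Hessian of `½F²` is at most that of `½(rK)²`, whose value at `X` is
  -- `(rK)²/(η² + q²)`, and `rK = F`.
  have hsec : fderiv ℝ (fderiv ℝ fun z => 1 / 2 * F z ^ 2) y X X ≤ F y ^ 2 / (η y ^ 2 + q ^ 2) := by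
    refine hcomp.trans_eq ?_
    rw [hyX, hXX, hηX, hF, hK]
    have e1 : μ ^ 2 * (s * q₀ ^ 2) / q = s * q := by
      rw [hq]; field_simp
    have e2 : s * q + g * q ^ 2 * 1 / (η y ^ 2 + q ^ 2) = 0 := by
      rw [hs]; field_simp; ring
    have e3 : μ ^ 2 * (s ^ 2 * q₀ ^ 2) - (s * q) ^ 2 = 0 := by
      rw [hq]; ring
    have e4 : ∀ B S D e : ℝ, 0 < B → 0 < D →
        r ^ 2 * (e * (S / B * (D * 0 ^ 2 + 0 * B + B ^ 2 * 1 ^ 2 / D)))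
          = r ^ 2 * (e * (B * S)) / D := by
      intro B S D e hB hD
      field_simp
      ring
    rw [e1, e2, e3]
    exact e4 _ _ _ _ hB hbq
  have hlow := H.sq_mul_sq_le hy X
  rw [hηX] at hlow
  have hFpos : 0 < F y ^ 2 := pow_pos (H.pos hy) 2
  have hApos := H.form_pos hy
  have hlt : A y y < η y ^ 2 + q ^ 2 := by
    have : q₀ ^ 2 < q ^ 2 := by
      rw [hq]
      exact pow_lt_pow_left₀ (by nlinarith) hq₀pos.le two_ne_zero
    linarith
  -- Here `A < η² + q²` as `q > √(A - η²)`; this contradicts the Cauchy–Schwarz bound `F² ≤ A g_y(X,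
  -- X)`.
  have h1 : A y y * fderiv ℝ (fderiv ℝ fun z => 1 / 2 * F z ^ 2) y X X < F y ^ 2 := by
    calc _ ≤ A y y * (F y ^ 2 / (η y ^ 2 + q ^ 2)) := by gcongr
      _ < (η y ^ 2 + q ^ 2) * (F y ^ 2 / (η y ^ 2 + q ^ 2)) := by gcongr
      _ = F y ^ 2 := by field_simp
  linarith

/-- At a point off the axis, `r K ≤ F` cannot be an equality if `K` is stretched by `μ < 1`. -/
theorem not_contact_of_ge (H : HasQuadraticDualNorm F η A) (hg : -2 < g ∧ g < 2)
    (hμ0 : 0 < μ) (hμ : μ < 1) {r : ℝ} (hr : 0 < r)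
    (hle : ∀ y, y ≠ 0 → r * stretchedFinsleroid g ρ μ η A y ≤ F y) {y : V} (hy : y ≠ 0)
    (heq : r * stretchedFinsleroid g ρ μ η A y = F y) : A y y - η y ^ 2 = 0 := by
  by_contra hne
  have hQ : 0 < A y y - η y ^ 2 := lt_of_le_of_ne (sub_nonneg.2 (H.sq_le_form y)) (Ne.symm hne)
  set q₀ := √(A y y - η y ^ 2) with hq₀
  have hq₀pos : 0 < q₀ := Real.sqrt_pos.2 hQ
  have hq₀sq : q₀ ^ 2 = A y y - η y ^ 2 := Real.sq_sqrt hQ.le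
  obtain ⟨q, hq⟩ : ∃ q, q = μ * q₀ := ⟨_, rfl⟩
  have hqpos : 0 < q := by rw [hq]; positivity
  -- The test vector is now dual to `η` for `F`, so `g_y(X, X) = η X` and `F² η X = A`. The contact
  -- gives `F² η X ≤ η² + q²`, which is less than `A` for `μ < 1`.
  obtain ⟨X, hX, hXA⟩ := H.quadratic y hy
  have hXpos := H.apply_dual_pos hy hX
  obtain ⟨e', he, he'⟩ := H.exists_deriv_stretchedFinsleroid (ρ := ρ) hg hμ0 hq hqpos X rfl rfl
  obtain ⟨f', hf, hf'⟩ := H.exists_line_second_deriv hy X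
  have hnear : ∀ᶠ t in 𝓝 (0 : ℝ), y + t • X ≠ 0 :=
    (tendsto_line y X).eventually (isOpen_ne.mem_nhds hy)
  have hB := finsleroid_quadratic_pos hg (b := η y) (Or.inr hqpos.ne')
  have hcomp := second_deriv_le_of_contact
    (φ := fun t => r ^ 2 * (1 / 2 * stretchedFinsleroid g ρ μ η A (y + t • X) ^ 2))
    (φ' := fun t => r ^ 2 * e' t)
    (by filter_upwards [he] with t ht using ht.const_mul _) (he'.const_mul _) hf hf'
    (by
      filter_upwards [hnear] with t ht
      have h1 := hle _ ht
      have h2 := H.stretchedFinsleroid_pos (ρ := ρ) hg hμ0 ht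
      have h3 := pow_le_pow_left₀ (by positivity) h1 2
      rw [mul_pow] at h3
      linarith)
    (by simp only [zero_smul, add_zero, ← heq]; ring)
  have hK : stretchedFinsleroid g ρ μ η A y ^ 2 = Real.exp ρ ^ 2 *
      ((η y ^ 2 + g * q * η y + q ^ 2) * finsleroidFactor g (η y) q) := by
    unfold stretchedFinsleroid
    rw [← hq₀, ← hq, mul_pow, finsleroidFun_sq hg _ hqpos]
  have hF : F y ^ 2 = r ^ 2 * stretchedFinsleroid g ρ μ η A y ^ 2 := by rw [← heq, mul_pow]
  have hbq : 0 < η y ^ 2 + q ^ 2 := by positivity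
  -- Cauchy–Schwarz for the nonnegative form `A - η²`, which makes the transverse term of the
  -- Hessian of `½K²` nonnegative.
  have hCS : (A y X - η y * η X) ^ 2 ≤ (A y y - η y ^ 2) * (A X X - η X ^ 2) := by
    have h := H.sq_le_form
      ((A y y - η y ^ 2) • X - (A y X - η y * η X) • y)
    simp only [map_smul, map_sub, LinearMap.smul_apply, LinearMap.sub_apply, smul_eq_mul,
      H.symm X y] at h
    have h2 : 0 ≤ (A y y - η y ^ 2) * ((A y y - η y ^ 2) * (A X X - η X ^ 2)
        - (A y X - η y * η X) ^ 2) := by linarith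
    have h3 := nonneg_of_mul_nonneg_right h2 hQ
    linarith
  have hZσ : 0 ≤ μ ^ 2 * (A X X - η X ^ 2) - (μ ^ 2 * (A y X - η y * η X) / q) ^ 2 := by
    have : (μ ^ 2 * (A y X - η y * η X) / q) ^ 2
        = μ ^ 2 * ((A y X - η y * η X) ^ 2 / (A y y - η y ^ 2)) := by
      rw [hq, ← hq₀sq]; field_simp
    rw [this, ← mul_sub]
    have : (A y X - η y * η X) ^ 2 / (A y y - η y ^ 2) ≤ A X X - η X ^ 2 := by
      rw [div_le_iff₀ hQ]; linarith
    exact mul_nonneg (sq_nonneg _) (by linarith)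
  have hfac := finsleroidFactor_pos g (η y) q
  have hsec : F y ^ 2 / (η y ^ 2 + q ^ 2) * η X ^ 2 ≤
      fderiv ℝ (fderiv ℝ fun z => 1 / 2 * F z ^ 2) y X X := by
    refine le_trans ?_ hcomp
    rw [hF, hK]
    have e1 : r ^ 2 * (Real.exp ρ ^ 2 * ((η y ^ 2 + g * q * η y + q ^ 2) *
        finsleroidFactor g (η y) q)) / (η y ^ 2 + q ^ 2) * η X ^ 2
        = r ^ 2 * (Real.exp ρ ^ 2 * (finsleroidFactor g (η y) q /
          (η y ^ 2 + g * q * η y + q ^ 2) *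
          ((η y ^ 2 + g * q * η y + q ^ 2) ^ 2 * η X ^ 2 / (η y ^ 2 + q ^ 2)))) := by
      field_simp
    rw [e1]
    gcongr
    refine le_add_of_nonneg_left (add_nonneg ?_ ?_)
    · positivity
    · exact mul_nonneg hZσ hB.le
  rw [hX X] at hsec
  have hFpos : 0 < F y ^ 2 := pow_pos (H.pos hy) 2
  have hlt : η y ^ 2 + q ^ 2 < A y y := by
    have : q ^ 2 < q₀ ^ 2 := by
      rw [hq]
      exact pow_lt_pow_left₀ (by nlinarith) (by positivity) two_ne_zero
    linarith
  have h1 : F y ^ 2 * η X ≤ η y ^ 2 + q ^ 2 := by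
    rw [div_mul_eq_mul_div, div_le_iff₀ hbq] at hsec
    refine le_of_mul_le_mul_right ?_ hXpos
    linarith
  linarith

/-- A Minkowski norm with quadratic `F² |η|²` is a Finsleroid. -/
theorem exists_eq_finsleroid [FiniteDimensional ℝ V] (H : HasQuadraticDualNorm F η A) :
    ∃ g ρ : ℝ, (-2 < g ∧ g < 2) ∧
      ∀ y, F y = Real.exp ρ * finsleroidFun g (η y) (√(A y y - η y ^ 2)) := by
  obtain ⟨w, hw, hw1⟩ := H.exists_dual_vector
  have hw0 : w ≠ 0 := by rintro rfl; simp at hw1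
  have hF₁ := H.pos hw0
  have hF₂ := H.pos (neg_ne_zero.2 hw0)
  -- The values at the poles `±w` are `e^{ρ ± Gπ/4}`; `G` and `ρ` are solved from these two
  -- equations.
  obtain ⟨G, hG⟩ : ∃ G, G = 2 / Real.pi * (Real.log (F w) - Real.log (F (-w))) := ⟨_, rfl⟩
  obtain ⟨ρ, hρ⟩ : ∃ ρ, ρ = 1 / 2 * (Real.log (F w) + Real.log (F (-w))) := ⟨_, rfl⟩
  have hs : 0 < 1 + G ^ 2 / 4 := by positivity
  -- The inverse of `g ↦ g/√(1 - g²/4)`; its values lie in `(-2, 2)` automatically.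
  obtain ⟨g, hgdef⟩ : ∃ g, g = G / √(1 + G ^ 2 / 4) := ⟨_, rfl⟩
  have hg2 : 1 - g ^ 2 / 4 = (1 + G ^ 2 / 4)⁻¹ := by
    rw [hgdef, div_pow, Real.sq_sqrt hs.le]; field_simp; ring
  have hg : -2 < g ∧ g < 2 := by
    have : 0 < 1 - g ^ 2 / 4 := by rw [hg2]; positivity
    rw [← abs_lt]
    exact abs_lt_of_sq_lt_sq (by linarith) (by norm_num)
  have hgG : g / √(1 - g ^ 2 / 4) = G := by
    have := Real.sqrt_pos.2 hs
    rw [hg2, Real.sqrt_inv, hgdef]; field_simp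
  -- Stretching does not affect the axis, so one choice of `g` and `ρ` serves every `μ`.
  have hpole : ∀ μ, F w = stretchedFinsleroid g ρ μ η A w ∧
      F (-w) = stretchedFinsleroid g ρ μ η A (-w) := by
    intro μ
    have hpi := Real.pi_pos.ne'
    constructor
    · have h0 : A w w - η w ^ 2 = 0 := by rw [hw, hw1]; ring
      rw [stretchedFinsleroid, h0, Real.sqrt_zero, mul_zero, hw1,
        finsleroidFun_zero_of_pos one_pos, hgG, mul_one, ← Real.exp_add]
      nth_rw 1 [← Real.exp_log hF₁]
      congr 1
      rw [hρ, hG]; field_simp; ring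
    · have h0 : A (-w) (-w) - η (-w) ^ 2 = 0 := by simp [hw, hw1]
      rw [stretchedFinsleroid, h0, Real.sqrt_zero, mul_zero, map_neg, hw1,
        finsleroidFun_zero_of_neg (by norm_num), hgG, neg_neg, mul_one, ← Real.exp_add]
      nth_rw 1 [← Real.exp_log hF₂]
      congr 1
      rw [hρ, hG]; field_simp; ring
  refine ⟨g, ρ, hg, fun y => ?_⟩
  by_cases hy : y = 0
  · simp [hy, H.apply_zero]
  have : ProperSpace V := FiniteDimensional.proper ℝ V
  have hne : ∀ y ∈ Metric.sphere (0 : V) 1, y ≠ 0 := fun y hy => ne_zero_of_mem_unit_sphere ⟨y, hy⟩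
  have hcont : ∀ μ, 0 < μ → ContinuousOn (fun y => F y / stretchedFinsleroid g ρ μ η A y)
      (Metric.sphere (0 : V) 1) := by
    intro μ hμ y hy
    exact ((H.contDiffAt y (hne y hy)).continuousAt.div
      (H.continuousAt_stretchedFinsleroid hg hμ (hne y hy))
      (H.stretchedFinsleroid_pos hg hμ (hne y hy)).ne').continuousWithinAt
  have hunit : ∀ y : V, y ≠ 0 → ‖y‖⁻¹ • y ∈ Metric.sphere (0 : V) 1 := by
    intro y hy
    simp [norm_smul, hy]
  have hratio : ∀ μ y, y ≠ 0 → F (‖y‖⁻¹ • y) / stretchedFinsleroid g ρ μ η A (‖y‖⁻¹ • y)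
      = F y / stretchedFinsleroid g ρ μ η A y := by
    intro μ y hy
    have hn : 0 < ‖y‖⁻¹ := by positivity
    rw [H.homogeneous y _ hn, stretchedFinsleroid_smul _ hn, mul_div_mul_left _ _ hn.ne']
  have hupper : ∀ μ, 1 < μ → F y ≤ stretchedFinsleroid g ρ μ η A y := by
    intro μ hμ
    have hμ0 : 0 < μ := by linarith
    obtain ⟨y₀, hy₀, hmax⟩ :=
      (isCompact_sphere (0 : V) 1).exists_isMaxOn ⟨_, hunit y hy⟩ (hcont μ hμ0)
    have h₀ := hne y₀ hy₀
    have hKpos := H.stretchedFinsleroid_pos (ρ := ρ) hg hμ0 h₀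
    set r := F y₀ / stretchedFinsleroid g ρ μ η A y₀ with hr
    have hrpos : 0 < r := div_pos (H.pos h₀) hKpos
    have heq : F y₀ = r * stretchedFinsleroid g ρ μ η A y₀ := by
      rw [hr, div_mul_cancel₀ _ hKpos.ne']
    have hle : ∀ y, y ≠ 0 → F y ≤ r * stretchedFinsleroid g ρ μ η A y := by
      intro y hy
      have h1 : F (‖y‖⁻¹ • y) / stretchedFinsleroid g ρ μ η A (‖y‖⁻¹ • y) ≤ r := hmax (hunit y hy)
      rwa [hratio μ y hy, div_le_iff₀ (H.stretchedFinsleroid_pos hg hμ0 hy)] at h1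
    have hax := H.not_contact_of_le hg hw hw1 hμ hrpos hle h₀ heq
    have h1 := H.eq_stretchedFinsleroid_of_form_eq_sq hw hw1 (hpole μ).1 (hpole μ).2 h₀ hax
    have hr1 : r = 1 := by rw [hr, h1, div_self hKpos.ne']
    simpa [hr1] using hle y hy
  have hlower : ∀ μ, 0 < μ → μ < 1 → stretchedFinsleroid g ρ μ η A y ≤ F y := by
    intro μ hμ0 hμ
    obtain ⟨y₀, hy₀, hmin⟩ :=
      (isCompact_sphere (0 : V) 1).exists_isMinOn ⟨_, hunit y hy⟩ (hcont μ hμ0)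
    have h₀ := hne y₀ hy₀
    have hKpos := H.stretchedFinsleroid_pos (ρ := ρ) hg hμ0 h₀
    set r := F y₀ / stretchedFinsleroid g ρ μ η A y₀ with hr
    have hrpos : 0 < r := div_pos (H.pos h₀) hKpos
    have heq : r * stretchedFinsleroid g ρ μ η A y₀ = F y₀ := by
      rw [hr, div_mul_cancel₀ _ hKpos.ne']
    have hle : ∀ y, y ≠ 0 → r * stretchedFinsleroid g ρ μ η A y ≤ F y := by
      intro y hy
      have h1 : r ≤ F (‖y‖⁻¹ • y) / stretchedFinsleroid g ρ μ η A (‖y‖⁻¹ • y) := hmin (hunit y hy)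
      rwa [hratio μ y hy, le_div_iff₀ (H.stretchedFinsleroid_pos hg hμ0 hy)] at h1
    have hax := H.not_contact_of_ge hg hμ0 hμ hrpos hle h₀ heq
    have h1 := H.eq_stretchedFinsleroid_of_form_eq_sq hw hw1 (hpole μ).1 (hpole μ).2 h₀ hax
    have hr1 : r = 1 := by rw [hr, h1, div_self hKpos.ne']
    simpa [hr1] using hle y hy
  -- Strict stretching was needed for the contradictions; the limit `μ → 1` from both sides removes
  -- it.
  have hlim : Filter.Tendsto (fun μ => stretchedFinsleroid g ρ μ η A y) (𝓝 1)
      (𝓝 (Real.exp ρ * finsleroidFun g (η y) (√(A y y - η y ^ 2)))) := by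
    have h1 : ContinuousAt (fun μ => stretchedFinsleroid g ρ μ η A y) 1 := by
      refine continuousAt_const.mul ?_
      refine ContinuousAt.comp (f := fun μ : ℝ => (η y, μ * √(A y y - η y ^ 2)))
        (continuousAt_finsleroidFun hg (H.ne_or_sqrt_pos one_pos hy)) ?_
      exact Continuous.continuousAt (by fun_prop)
    simpa [stretchedFinsleroid] using h1.tendsto
  refine le_antisymm ?_ ?_
  · refine ge_of_tendsto (hlim.mono_left (nhdsWithin_le_nhds (s := Set.Ioi 1))) ?_
    filter_upwards [self_mem_nhdsWithin] with μ hμ using hupper μ hμ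
  · refine le_of_tendsto (hlim.mono_left (nhdsWithin_le_nhds (s := Set.Iio 1))) ?_
    filter_upwards [self_mem_nhdsWithin, nhdsWithin_le_nhds (lt_mem_nhds zero_lt_one)]
      with μ hμ hμ0 using hlower μ hμ0 hμ

end HasQuadraticDualNorm

end FinslerConformal

namespace FinslerConformal

/-! ### Regularity of the coordinate expressions -/

/-! ### Smoothness of determinants and inverse matrices. -/

section MatrixInverse

variable {W : Type*} [NormedAddCommGroup W] [NormedSpace ℝ W] {n : ℕ} {m : WithTop ℕ∞}
  {M : W → Matrix (Fin n) (Fin n) ℝ} {z : W}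

theorem contDiffAt_matrix_det (h : ∀ i j, ContDiffAt ℝ m (fun z => M z i j) z) :
    ContDiffAt ℝ m (fun z => (M z).det) z := by
  simp only [Matrix.det_apply']
  exact ContDiffAt.sum fun σ _ => contDiffAt_const.mul (contDiffAt_prod fun i _ => h _ _)

/-- By Cramer's rule the entries of the inverse are minors divided by the determinant. -/
theorem contDiffAt_matrix_inv (h : ∀ i j, ContDiffAt ℝ m (fun z => M z i j) z)
    (hdet : (M z).det ≠ 0) (i j : Fin n) : ContDiffAt ℝ m (fun z => (M z)⁻¹ i j) z := by
  simp only [Matrix.inv_def, Ring.inverse_eq_inv', Matrix.smul_apply, smul_eq_mul,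
    Matrix.adjugate_apply]
  refine ((contDiffAt_matrix_det h).inv hdet).mul (contDiffAt_matrix_det fun k l => ?_)
  by_cases hk : k = j
  · subst hk
    simpa using contDiffAt_const
  · simpa [Matrix.updateRow_ne hk] using h k l

end MatrixInverse

variable {n : ℕ}

theorem fderiv_apply_eq_sum_pd (φ : Coord n → ℝ) (x v : Coord n) :
    fderiv ℝ φ x v = ∑ i, pd i φ x * v i := by
  have hv : v = ∑ i, v i • EuclideanSpace.single i (1 : ℝ) := by
    simpa using ((EuclideanSpace.basisFun (Fin n) ℝ).sum_repr v).symm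
  conv_lhs => rw [hv]
  simp [pd, mul_comm]

theorem clm_apply_eq_sum (L : Coord n →L[ℝ] ℝ) (v : Coord n) :
    L v = ∑ i, L (EuclideanSpace.single i 1) * v i := by
  have h := fderiv_apply_eq_sum_pd L 0 v
  simpa [pd] using h

theorem _root_.Filter.EventuallyEq.pd_eventuallyEq {φ ψ : Coord n → ℝ} {y : Coord n}
    (h : φ =ᶠ[𝓝 y] ψ) (i : Fin n) : pd i φ =ᶠ[𝓝 y] pd i ψ := by
  filter_upwards [h.fderiv (𝕜 := ℝ)] with z hz
  simp [pd, hz]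

theorem contDiffAt_pd {φ : Coord n → ℝ} {y : Coord n} {m k : WithTop ℕ∞} (h : ContDiffAt ℝ k φ y)
    (hmk : m + 1 ≤ k) (i : Fin n) : ContDiffAt ℝ m (pd i φ) y :=
  (h.fderiv_right hmk).clm_apply contDiffAt_const

theorem pd_pd_eq {φ : Coord n → ℝ} {y : Coord n} (h : ContDiffAt ℝ 2 φ y) (i j : Fin n) :
    pd i (pd j φ) y
      = fderiv ℝ (fderiv ℝ φ) y (EuclideanSpace.single i 1) (EuclideanSpace.single j 1) := by
  have h1 := differentiableAt_fderiv_of_contDiffAt_two h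
  have h2 : HasFDerivAt (pd j φ) _ y := h1.hasFDerivAt.clm_apply (hasFDerivAt_const _ y)
  rw [pd, h2.fderiv]
  simp

/-! ### Partial derivatives in `x` and `y` as derivatives on the product space. -/

section Slices

variable {u : Coord n × Coord n → ℝ} {x y : Coord n}

theorem pd_snd (h : DifferentiableAt ℝ u (x, y)) (i : Fin n) :
    pd i (fun y' => u (x, y')) y = fderiv ℝ u (x, y) (0, EuclideanSpace.single i 1) := by
  have h1 : HasFDerivAt (fun y' => u (x, y')) _ y :=
    h.hasFDerivAt.comp y (hasFDerivAt_prodMk_right x y)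
  rw [pd, h1.fderiv]
  simp

theorem pd_fst (h : DifferentiableAt ℝ u (x, y)) (i : Fin n) :
    pd i (fun x' => u (x', y)) x = fderiv ℝ u (x, y) (EuclideanSpace.single i 1, 0) := by
  have h1 : HasFDerivAt (fun x' => u (x', y)) _ x :=
    h.hasFDerivAt.comp x (hasFDerivAt_prodMk_left x y)
  rw [pd, h1.fderiv]
  simp

theorem eventually_differentiableAt (h : ContDiffAt ℝ 1 u (x, y)) :
    ∀ᶠ z in 𝓝 (x, y), DifferentiableAt ℝ u z := by
  filter_upwards [h.eventually (by simp)] with z hz using hz.differentiableAt (by simp)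

theorem tendsto_prodMk_right (x y : Coord n) :
    Filter.Tendsto (fun y' => (x, y')) (𝓝 y) (𝓝 (x, y)) :=
  (Continuous.prodMk_right x).continuousAt.tendsto

theorem pd_snd_pd_snd (h : ContDiffAt ℝ 2 u (x, y)) (i j : Fin n) :
    pd i (fun y' => pd j (fun y'' => u (x, y'')) y') y
      = fderiv ℝ (fun z => fderiv ℝ u z (0, EuclideanSpace.single j 1)) (x, y)
        (0, EuclideanSpace.single i 1) := by
  have h1 : (fun y' => pd j (fun y'' => u (x, y'')) y') =ᶠ[𝓝 y]
      fun y' => fderiv ℝ u (x, y') (0, EuclideanSpace.single j 1) := by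
    filter_upwards [(tendsto_prodMk_right x y).eventually
      (eventually_differentiableAt (h.of_le (by norm_num)))] with y' hy'
    exact pd_snd hy' j
  rw [(h1.pd_eventuallyEq i).self_of_nhds]
  refine pd_snd (u := fun z => fderiv ℝ u z (0, EuclideanSpace.single j 1)) ?_ i
  exact ((h.fderiv_right (m := 1) (by norm_num)).clm_apply contDiffAt_const).differentiableAt
    (by norm_num)

theorem pd_snd_pd_fst (h : ContDiffAt ℝ 2 u (x, y)) (i j : Fin n) :
    pd i (fun y' => pd j (fun x' => u (x', y')) x) y
      = fderiv ℝ (fun z => fderiv ℝ u z (EuclideanSpace.single j 1, 0)) (x, y)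
        (0, EuclideanSpace.single i 1) := by
  have h1 : (fun y' => pd j (fun x' => u (x', y')) x) =ᶠ[𝓝 y]
      fun y' => fderiv ℝ u (x, y') (EuclideanSpace.single j 1, 0) := by
    filter_upwards [(tendsto_prodMk_right x y).eventually
      (eventually_differentiableAt (h.of_le (by norm_num)))] with y' hy'
    exact pd_fst hy' j
  rw [(h1.pd_eventuallyEq i).self_of_nhds]
  refine pd_snd (u := fun z => fderiv ℝ u z (EuclideanSpace.single j 1, 0)) ?_ i
  exact ((h.fderiv_right (m := 1) (by norm_num)).clm_apply contDiffAt_const).differentiableAt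
    (by norm_num)

theorem contDiffAt_pd_snd_pd_snd {m : WithTop ℕ∞} {z : Coord n × Coord n}
    (h : ContDiffAt ℝ (m + 2) u z) (i j : Fin n) :
    ContDiffAt ℝ m (fun z => pd i (fun y' => pd j (fun y'' => u (z.1, y'')) y') z.2) z := by
  have h2 : ContDiffAt ℝ 2 u z := h.of_le le_add_self
  have h1 : ContDiffAt ℝ m (fun z => fderiv ℝ (fun z => fderiv ℝ u z
      (0, EuclideanSpace.single j 1)) z (0, EuclideanSpace.single i 1)) z := by
    have h3 : ContDiffAt ℝ (m + 1) (fun z => fderiv ℝ u z (0, EuclideanSpace.single j 1)) z :=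
      (h.fderiv_right (m := m + 1) (by rw [add_assoc, one_add_one_eq_two])).clm_apply
        contDiffAt_const
    exact (h3.fderiv_right le_rfl).clm_apply contDiffAt_const
  refine h1.congr_of_eventuallyEq ?_
  filter_upwards [h2.eventually (by simp)] with z hz
  exact pd_snd_pd_snd hz i j

theorem contDiffAt_pd_snd_pd_fst {m : WithTop ℕ∞} {z : Coord n × Coord n}
    (h : ContDiffAt ℝ (m + 2) u z) (i j : Fin n) :
    ContDiffAt ℝ m (fun z => pd i (fun y' => pd j (fun x' => u (x', y')) z.1) z.2) z := by
  have h2 : ContDiffAt ℝ 2 u z := h.of_le le_add_self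
  have h1 : ContDiffAt ℝ m (fun z => fderiv ℝ (fun z => fderiv ℝ u z
      (EuclideanSpace.single j 1, 0)) z (0, EuclideanSpace.single i 1)) z := by
    have h3 : ContDiffAt ℝ (m + 1) (fun z => fderiv ℝ u z (EuclideanSpace.single j 1, 0)) z :=
      (h.fderiv_right (m := m + 1) (by rw [add_assoc, one_add_one_eq_two])).clm_apply
        contDiffAt_const
    exact (h3.fderiv_right le_rfl).clm_apply contDiffAt_const
  refine h1.congr_of_eventuallyEq ?_
  filter_upwards [h2.eventually (by simp)] with z hz
  exact pd_snd_pd_fst hz i j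

theorem contDiffAt_pd_fst {m : WithTop ℕ∞} {z : Coord n × Coord n}
    (h : ContDiffAt ℝ (m + 1) u z) (i : Fin n) :
    ContDiffAt ℝ m (fun z => pd i (fun x' => u (x', z.2)) z.1) z := by
  have h2 : ContDiffAt ℝ 1 u z := h.of_le le_add_self
  refine ((h.fderiv_right le_rfl).clm_apply (contDiffAt_const
    (c := ((EuclideanSpace.single i 1, 0) : Coord n × Coord n)))).congr_of_eventuallyEq ?_
  filter_upwards [eventually_differentiableAt h2] with z hz
  exact pd_fst hz i

end Slices

variable {f : Coord n → Coord n → ℝ}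

theorem contDiffAt_energy {m : WithTop ℕ∞} {z : Coord n × Coord n}
    (h : ContDiffAt ℝ m (fun z : Coord n × Coord n => f z.1 z.2) z) :
    ContDiffAt ℝ m (fun z : Coord n × Coord n => energy f z.1 z.2) z :=
  contDiffAt_const.mul (h.pow 2)

theorem contDiffAt_gMat {m : WithTop ℕ∞} {z : Coord n × Coord n}
    (h : ContDiffAt ℝ (m + 2) (fun z : Coord n × Coord n => f z.1 z.2) z) (i j : Fin n) :
    ContDiffAt ℝ m (fun z : Coord n × Coord n => gMat f z.1 z.2 i j) z :=
  contDiffAt_pd_snd_pd_snd (contDiffAt_energy h) i j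

theorem contDiffAt_spray {m : WithTop ℕ∞} {z : Coord n × Coord n}
    (h : ContDiffAt ℝ (m + 2) (fun z : Coord n × Coord n => f z.1 z.2) z)
    (hdet : (gMat f z.1 z.2).det ≠ 0) (l : Fin n) :
    ContDiffAt ℝ m (fun z : Coord n × Coord n => spray f l z.1 z.2) z := by
  have hE := contDiffAt_energy h
  refine contDiffAt_const.mul (ContDiffAt.sum fun i _ => ?_)
  refine (contDiffAt_matrix_inv (contDiffAt_gMat h) hdet l i).mul
    ((ContDiffAt.sum fun k _ => ?_).sub ?_)
  · refine ContDiffAt.mul ?_ (contDiffAt_pd_snd_pd_fst hE i k)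
    fun_prop
  · exact contDiffAt_pd_fst (u := fun z : Coord n × Coord n => energy f z.1 z.2)
      (hE.of_le (by gcongr; norm_num)) i

end FinslerConformal

namespace FinslerConformal

/-! ### Conformal change of the spray -/

variable {n : ℕ} {f : Coord n → Coord n → ℝ} {a : Coord n → ℝ} {x y : Coord n}

theorem contDiffAt_slice {m : WithTop ℕ∞}
    (h : ContDiffAt ℝ m (fun z : Coord n × Coord n => f z.1 z.2) (x, y)) :
    ContDiffAt ℝ m (f x) y :=
  h.comp y (f := fun y' => (x, y')) (by fun_prop)

theorem contDiffAt_energy_slice {m : WithTop ℕ∞} (h : ContDiffAt ℝ m (f x) y) :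
    ContDiffAt ℝ m (energy f x) y :=
  contDiffAt_const.mul (h.pow 2)

theorem energy_homogeneous (hf : ∀ (y : Coord n) (t : ℝ), 0 < t → f x (t • y) = t * f x y)
    (y : Coord n) (_ : y ≠ 0) (t : ℝ) (ht : 0 < t) :
    energy f x (t • y) = t ^ 2 * energy f x y := by
  simp only [energy, hf y t ht]; ring

theorem gMat_apply (h : ContDiffAt ℝ 2 (f x) y) (i j : Fin n) :
    gMat f x y i j = fderiv ℝ (fderiv ℝ (energy f x)) y (EuclideanSpace.single i 1)
      (EuclideanSpace.single j 1) :=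
  pd_pd_eq (contDiffAt_energy_slice h) i j

theorem hessian_eq_sum_gMat (h : ContDiffAt ℝ 2 (f x) y) (v w : Coord n) :
    fderiv ℝ (fderiv ℝ (energy f x)) y v w = ∑ i, ∑ j, gMat f x y i j * v i * w j := by
  rw [clm_apply_eq_sum]
  have : ∀ j, fderiv ℝ (fderiv ℝ (energy f x)) y v (EuclideanSpace.single j 1)
      = ∑ i, gMat f x y i j * v i := by
    intro j
    have h1 := clm_apply_eq_sum ((fderiv ℝ (fderiv ℝ (energy f x)) y).flip
      (EuclideanSpace.single j 1)) v
    simpa [gMat_apply h] using h1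
  simp only [this, Finset.sum_mul]
  exact Finset.sum_comm

theorem gMat_mulVec_self (h : ContDiffAt ℝ 2 (f x) y) (hy : y ≠ 0)
    (hf : ∀ (y : Coord n) (t : ℝ), 0 < t → f x (t • y) = t * f x y) (i : Fin n) :
    ∑ j, gMat f x y i j * y j = pd i (energy f x) y := by
  have hE := contDiffAt_energy_slice h
  have h1 := fderiv_fderiv_apply_self_of_homogeneous_two (energy_homogeneous hf) hy
    (differentiableAt_fderiv_of_contDiffAt_two hE)
  have h2 := (hE.isSymmSndFDerivAt (by simp)).eq y (EuclideanSpace.single i 1)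
  rw [h1] at h2
  rw [pd, h2, clm_apply_eq_sum]
  simp [gMat_apply h]

/-- Euler's relation `gᵢⱼ yʲ = ∂E/∂yⁱ`, inverted. It turns the `∂E/∂yᵐ` terms of the conformal
change into multiples of `yˡ`. -/
theorem inv_gMat_mulVec_pd (h : ContDiffAt ℝ 2 (f x) y) (hy : y ≠ 0)
    (hf : ∀ (y : Coord n) (t : ℝ), 0 < t → f x (t • y) = t * f x y)
    (hdet : (gMat f x y).det ≠ 0) (l : Fin n) :
    ∑ m, (gMat f x y)⁻¹ l m * pd m (energy f x) y = y l := by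
  have h1 : (gMat f x y).mulVec (fun j => y j) = fun i => pd i (energy f x) y := by
    ext i
    exact gMat_mulVec_self h hy hf i
  have h2 : (gMat f x y)⁻¹.mulVec ((gMat f x y).mulVec (fun j => y j)) = fun j => y j := by
    rw [Matrix.mulVec_mulVec, Matrix.nonsing_inv_mul _ (isUnit_iff_ne_zero.2 hdet),
      Matrix.one_mulVec]
  rw [h1] at h2
  exact congrFun h2 l

theorem energy_exp_mul (x y : Coord n) :
    energy (fun x y => Real.exp (a x) * f x y) x y = Real.exp (a x) ^ 2 * energy f x y := by
  simp only [energy]; ring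

theorem pd_const_mul (c : ℝ) (φ : Coord n → ℝ) (i : Fin n) (y : Coord n) :
    pd i (fun y => c * φ y) y = c * pd i φ y := by
  have : fderiv ℝ (fun y => c * φ y) y = c • fderiv ℝ φ y :=
    congrFun (fderiv_const_smul_field (f := φ) c) y
  simp [pd, this]

theorem gMat_exp_mul (x y : Coord n) :
    gMat (fun x y => Real.exp (a x) * f x y) x y = Real.exp (a x) ^ 2 • gMat f x y := by
  ext i j
  simp only [gMat, Matrix.of_apply, Matrix.smul_apply, smul_eq_mul, energy_exp_mul, pd_const_mul]

theorem pd_exp_sq_mul {φ : Coord n → ℝ} (ha : DifferentiableAt ℝ a x)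
    (hφ : DifferentiableAt ℝ φ x) (k : Fin n) :
    pd k (fun x' => Real.exp (a x') ^ 2 * φ x') x
      = Real.exp (a x) ^ 2 * (2 * pd k a x * φ x + pd k φ x) := by
  have h : HasFDerivAt (fun x' => Real.exp (a x') ^ 2 * φ x') _ x :=
    (ha.hasFDerivAt.exp.pow 2).mul hφ.hasFDerivAt
  rw [pd, h.fderiv]
  simp [pd]
  ring

/-- The factor `e^{2a}` of the energy cancels against the inverse metric. Its `x`-derivatives add
`2(aₖyᵏ) ∂E/∂yᵐ - 2aₘE` to the bracket of the spray, and `½gˡᵐ` of this is the stated change. -/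
theorem spray_exp_mul (h : ContDiffAt ℝ 2 (fun z : Coord n × Coord n => f z.1 z.2) (x, y))
    (hy : y ≠ 0) (hf : ∀ (y : Coord n) (t : ℝ), 0 < t → f x (t • y) = t * f x y)
    (hdet : (gMat f x y).det ≠ 0) (ha : DifferentiableAt ℝ a x) (l : Fin n) :
    spray (fun x y => Real.exp (a x) * f x y) l x y
      = spray f l x y + ((∑ k, pd k a x * y k) * y l
        - energy f x y * ∑ m, (gMat f x y)⁻¹ l m * pd m a x) := by
  have hE := contDiffAt_energy h
  have hexp : Real.exp (a x) ^ 2 ≠ 0 := by positivity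
  have hdiff : ∀ᶠ y' in 𝓝 y, DifferentiableAt ℝ (fun x' => energy f x' y') x := by
    filter_upwards [(tendsto_prodMk_right x y).eventually
      (eventually_differentiableAt (hE.of_le (by norm_num)))] with y' hy'
    exact DifferentiableAt.comp x (f := fun x' => (x', y')) hy' (by fun_prop)
  have hmix : ∀ m k, pd m (fun y' => pd k (fun x' =>
        energy (fun x y => Real.exp (a x) * f x y) x' y') x) y
      = Real.exp (a x) ^ 2 * (2 * pd k a x * pd m (energy f x) y
        + pd m (fun y' => pd k (fun x' => energy f x' y') x) y) := by
    intro m k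
    have h1 : (fun y' => pd k (fun x' =>
        energy (fun x y => Real.exp (a x) * f x y) x' y') x) =ᶠ[𝓝 y]
        fun y' => Real.exp (a x) ^ 2 * (2 * pd k a x * energy f x y'
          + pd k (fun x' => energy f x' y') x) := by
      filter_upwards [hdiff] with y' hy'
      simp only [energy_exp_mul]
      exact pd_exp_sq_mul ha hy' k
    rw [(h1.pd_eventuallyEq m).self_of_nhds, pd_const_mul]
    congr 1
    have h2 : DifferentiableAt ℝ (energy f x) y :=
      (contDiffAt_energy_slice (contDiffAt_slice h)).differentiableAt (by norm_num)
    have h3 : DifferentiableAt ℝ (fun y' => pd k (fun x' => energy f x' y') x) y := by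
      have h4 : ContDiffAt ℝ 1 (fun z : Coord n × Coord n =>
          pd k (fun x' => energy f x' z.2) z.1) (x, y) :=
        contDiffAt_pd_fst (u := fun z : Coord n × Coord n => energy f z.1 z.2)
          (hE.of_le (by norm_num)) k
      exact (h4.comp y (f := fun y' => (x, y')) (by fun_prop)).differentiableAt (by norm_num)
    have h5 : HasFDerivAt (fun y' => 2 * pd k a x * energy f x y'
        + pd k (fun x' => energy f x' y') x) _ y :=
      (h2.hasFDerivAt.const_mul (2 * pd k a x)).add h3.hasFDerivAt
    rw [pd, h5.fderiv]
    simp [pd]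
  have hfst : ∀ m, pd m (fun x' => energy (fun x y => Real.exp (a x) * f x y) x' y) x
      = Real.exp (a x) ^ 2 * (2 * pd m a x * energy f x y + pd m (fun x' => energy f x' y) x) := by
    intro m
    simp only [energy_exp_mul]
    exact pd_exp_sq_mul ha hdiff.self_of_nhds m
  have hinv : (gMat (fun x y => Real.exp (a x) * f x y) x y)⁻¹
      = (Real.exp (a x) ^ 2)⁻¹ • (gMat f x y)⁻¹ := by
    rw [gMat_exp_mul]
    have := Matrix.inv_smul' (A := gMat f x y) (Units.mk0 _ hexp) (isUnit_iff_ne_zero.2 hdet)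
    simpa [Units.smul_def] using this
  have hyl := inv_gMat_mulVec_pd (contDiffAt_slice h) hy hf hdet l
  simp only [spray, hinv, hmix, hfst, Matrix.smul_apply, smul_eq_mul]
  rw [← hyl]
  have hterm : ∀ m, (Real.exp (a x) ^ 2)⁻¹ * (gMat f x y)⁻¹ l m *
      (∑ k, y k * (Real.exp (a x) ^ 2 * (2 * pd k a x * pd m (energy f x) y
        + pd m (fun y' => pd k (fun x' => energy f x' y') x) y))
        - Real.exp (a x) ^ 2 * (2 * pd m a x * energy f x y + pd m (fun x' => energy f x' y) x))
      = (gMat f x y)⁻¹ l m * (∑ k, y k * pd m (fun y' => pd k (fun x' => energy f x' y') x) y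
          - pd m (fun x' => energy f x' y) x)
        + 2 * ((∑ k, pd k a x * y k) * ((gMat f x y)⁻¹ l m * pd m (energy f x) y))
        - 2 * (energy f x y * ((gMat f x y)⁻¹ l m * pd m a x)) := by
    intro m
    have e1 : ∑ k, y k * (Real.exp (a x) ^ 2 * (2 * pd k a x * pd m (energy f x) y
        + pd m (fun y' => pd k (fun x' => energy f x' y') x) y))
        = Real.exp (a x) ^ 2 * (2 * (∑ k, pd k a x * y k) * pd m (energy f x) y
          + ∑ k, y k * pd m (fun y' => pd k (fun x' => energy f x' y') x) y) := by
      rw [Finset.mul_sum, Finset.sum_mul, ← Finset.sum_add_distrib, Finset.mul_sum]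
      exact Finset.sum_congr rfl fun k _ => by ring
    rw [e1]
    field_simp
    ring
  simp only [hterm, Finset.sum_add_distrib, Finset.sum_sub_distrib, ← Finset.mul_sum]
  ring

/-! ### Third derivatives -/

theorem pd_add_eventuallyEq {φ ψ : Coord n → ℝ} {y : Coord n} (hφ : ContDiffAt ℝ ∞ φ y)
    (hψ : ContDiffAt ℝ ∞ ψ y) (i : Fin n) :
    pd i (fun y => φ y + ψ y) =ᶠ[𝓝 y] fun y => pd i φ y + pd i ψ y := by
  filter_upwards [(hφ.of_le (m := 1) (mod_cast le_top)).eventually (by simp),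
    (hψ.of_le (m := 1) (mod_cast le_top)).eventually (by simp)] with z h1 h2
  rw [pd, fderiv_fun_add (h1.differentiableAt (by simp)) (h2.differentiableAt (by simp))]
  rfl

theorem pd_sum_mul_eventuallyEq {φ : Fin n → Coord n → ℝ} {y : Coord n}
    (hφ : ∀ l, ContDiffAt ℝ ∞ (φ l) y) (c : Fin n → ℝ) (i : Fin n) :
    pd i (fun y => ∑ l, φ l y * c l) =ᶠ[𝓝 y] fun y => ∑ l, pd i (φ l) y * c l := by
  have h : ∀ᶠ z in 𝓝 y, ∀ l, DifferentiableAt ℝ (φ l) z := by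
    rw [Filter.eventually_all]
    intro l
    filter_upwards [((hφ l).of_le (m := 1) (mod_cast le_top)).eventually (by simp)] with z hz
      using hz.differentiableAt (by simp)
  filter_upwards [h] with z hz
  have h1 : HasFDerivAt (fun y => ∑ l, φ l y * c l) _ z :=
    HasFDerivAt.fun_sum fun l _ => (hz l).hasFDerivAt.mul_const (c l)
  rw [pd, h1.fderiv]
  simp [pd, mul_comm]

theorem contDiffAt_pd_infty {φ : Coord n → ℝ} {y : Coord n} (h : ContDiffAt ℝ ∞ φ y) (i : Fin n) :
    ContDiffAt ℝ ∞ (pd i φ) y :=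
  contDiffAt_pd h (by exact_mod_cast le_rfl) i

theorem pd_pd_pd_add {φ ψ : Coord n → ℝ} {y : Coord n} (hφ : ContDiffAt ℝ ∞ φ y)
    (hψ : ContDiffAt ℝ ∞ ψ y) (i j k : Fin n) :
    pd k (pd j (pd i fun y => φ y + ψ y)) y
      = pd k (pd j (pd i φ)) y + pd k (pd j (pd i ψ)) y := by
  have h1 := pd_add_eventuallyEq hφ hψ i
  have h2 := (h1.pd_eventuallyEq j).trans
    (pd_add_eventuallyEq (contDiffAt_pd_infty hφ i) (contDiffAt_pd_infty hψ i) j)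
  have h3 := (h2.pd_eventuallyEq k).trans
    (pd_add_eventuallyEq (contDiffAt_pd_infty (contDiffAt_pd_infty hφ i) j)
      (contDiffAt_pd_infty (contDiffAt_pd_infty hψ i) j) k)
  exact h3.self_of_nhds

theorem pd_pd_pd_sum_mul {φ : Fin n → Coord n → ℝ} {y : Coord n}
    (hφ : ∀ l, ContDiffAt ℝ ∞ (φ l) y) (c : Fin n → ℝ) (i j k : Fin n) :
    pd k (pd j (pd i fun y => ∑ l, φ l y * c l)) y = ∑ l, pd k (pd j (pd i (φ l))) y * c l := by
  have h1 := pd_sum_mul_eventuallyEq hφ c i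
  have h2 := (h1.pd_eventuallyEq j).trans
    (pd_sum_mul_eventuallyEq (fun l => contDiffAt_pd_infty (hφ l) i) c j)
  have h3 := (h2.pd_eventuallyEq k).trans (pd_sum_mul_eventuallyEq
    (fun l => contDiffAt_pd_infty (contDiffAt_pd_infty (hφ l) i) j) c k)
  exact h3.self_of_nhds

/-- A smooth 2-homogeneous function with vanishing third derivatives on a connected open set is a
quadratic form there. -/
theorem exists_quadratic_of_pd_pd_pd_eq_zero {Ω : Set (Coord n)} (hΩ : IsOpen Ω)
    (hconn : IsPreconnected Ω) (h0 : (0 : Coord n) ∉ Ω) {R : Coord n → ℝ}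
    (hR : ∀ y ∈ Ω, ContDiffAt ℝ ∞ R y)
    (hhom : ∀ y, y ≠ 0 → ∀ t : ℝ, 0 < t → R (t • y) = t ^ 2 * R y)
    (hzero : ∀ y ∈ Ω, ∀ i j k, pd k (pd j (pd i R)) y = 0) :
    ∃ c : Fin n → Fin n → ℝ, ∀ y ∈ Ω, R y = ∑ i, ∑ j, c i j * y i * y j := by
  have hconst : ∀ i j, ∃ c, ∀ y ∈ Ω, pd j (pd i R) y = c := by
    intro i j
    refine hΩ.exists_is_const_of_fderiv_eq_zero (𝕜 := ℝ) hconn ?_ ?_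
    · intro y hy
      exact ((contDiffAt_pd_infty (contDiffAt_pd_infty (hR y hy) i) j).differentiableAt
        (by simp)).differentiableWithinAt
    · intro y hy
      ext v
      rw [fderiv_apply_eq_sum_pd]
      simp [hzero y hy]
  choose c hc using hconst
  refine ⟨fun i j => 1 / 2 * c j i, fun y hy => ?_⟩
  have hy0 : y ≠ 0 := fun h => h0 (h ▸ hy)
  have h2 : ContDiffAt ℝ 2 R y := contDiffAt_infty.1 (hR y hy) 2
  -- Euler's identity used twice gives `2R(y) = D²R(y)(y, y)`, and the second derivatives are
  -- constant.
  have e1 := fderiv_apply_self_of_homogeneous_two hhom hy0 (h2.differentiableAt (by norm_num))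
  have e2 := fderiv_fderiv_apply_self_of_homogeneous_two hhom hy0
    (differentiableAt_fderiv_of_contDiffAt_two h2)
  rw [← e2, clm_apply_eq_sum] at e1
  have e3 : ∀ j, fderiv ℝ (fderiv ℝ R) y y (EuclideanSpace.single j 1) = ∑ i, c j i * y i := by
    intro j
    have h := clm_apply_eq_sum ((fderiv ℝ (fderiv ℝ R) y).flip (EuclideanSpace.single j 1)) y
    simp only [ContinuousLinearMap.flip_apply, ← pd_pd_eq h2] at h
    rw [h]
    exact Finset.sum_congr rfl fun i _ => by rw [hc j i y hy]
  simp only [e3, Finset.sum_mul] at e1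
  have e4 : R y = 1 / 2 * ∑ x, ∑ i, c x i * y i * y x := by linarith
  rw [e4, Finset.sum_comm, Finset.mul_sum]
  refine Finset.sum_congr rfl fun i _ => ?_
  rw [Finset.mul_sum]
  exact Finset.sum_congr rfl fun j _ => by ring

end FinslerConformal

namespace FinslerConformal

/-! ### Quadraticity of `F² |dα|²` -/

variable {n : ℕ}

/-- The bilinear form `cᵢⱼ vⁱ wʲ`. -/
def matrixForm (c : Matrix (Fin n) (Fin n) ℝ) : LinearMap.BilinForm ℝ (Coord n) :=
  LinearMap.mk₂ ℝ (fun v w => ∑ i, ∑ j, c i j * v i * w j)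
    (by intros; simp [mul_add, add_mul, Finset.sum_add_distrib])
    (by
      intros
      simp only [PiLp.smul_apply, smul_eq_mul, Finset.mul_sum]
      exact Finset.sum_congr rfl fun i _ => Finset.sum_congr rfl fun j _ => by ring)
    (by intros; simp [mul_add, Finset.sum_add_distrib])
    (by
      intros
      simp only [PiLp.smul_apply, smul_eq_mul, Finset.mul_sum]
      exact Finset.sum_congr rfl fun i _ => Finset.sum_congr rfl fun j _ => by ring)

theorem matrixForm_apply (c : Matrix (Fin n) (Fin n) ℝ) (v w : Coord n) :
    matrixForm c v w = ∑ i, ∑ j, c i j * v i * w j := rfl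

theorem matrixForm_single (c : Matrix (Fin n) (Fin n) ℝ) (i j : Fin n) :
    matrixForm c (EuclideanSpace.single i 1) (EuclideanSpace.single j 1) = c i j := by
  simp [matrixForm_apply]

theorem matrixForm_symm {c : Matrix (Fin n) (Fin n) ℝ} (hc : c.IsSymm) (v w : Coord n) :
    matrixForm c v w = matrixForm c w v := by
  rw [matrixForm_apply, matrixForm_apply, Finset.sum_comm]
  refine Finset.sum_congr rfl fun i _ => Finset.sum_congr rfl fun j _ => ?_
  rw [hc.apply i j]; ring

/-- The function `F² gˡᵐ aₗ aₘ` on the tangent bundle, in coordinates. -/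
def dualNormForm (f : Coord n → Coord n → ℝ) (a : Coord n → ℝ) (x y : Coord n) : ℝ :=
  f x y ^ 2 * ∑ l, ∑ m, (gMat f x y)⁻¹ l m * pd l a x * pd m a x

/-- The conditions at one point that a Finsler metric and a conformal change preserving the
contracted mixed curvature impose on the coordinate expressions. -/
structure IsContractedInvariantAt (f : Coord n → Coord n → ℝ) (a : Coord n → ℝ)
    (x : Coord n) : Prop where
  nonneg : ∀ y, 0 ≤ f x y
  contDiffAt_two : ∀ y, y ≠ 0 → ContDiffAt ℝ 2 (fun z : Coord n × Coord n => f z.1 z.2) (x, y)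
  homogeneous : ∀ (y : Coord n) (t : ℝ), 0 < t → f x (t • y) = t * f x y
  posDef : ∀ y, y ≠ 0 → (gMat f x y).PosDef
  contDiffAt_factor : ContDiffAt ℝ ∞ a x
  invariant : ∃ d : Coord n, ∀ y, y ∉ Submodule.span ℝ {d} →
    ContDiffAt ℝ ∞ (fun z : Coord n × Coord n => f z.1 z.2) (x, y) ∧
    ∀ i j k, ∑ l, berwaldP (fun x y => Real.exp (a x) * f x y) l i j k x y * pd l a x
        = ∑ l, berwaldP f l i j k x y * pd l a x

variable {f : Coord n → Coord n → ℝ} {a : Coord n → ℝ} {x : Coord n}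

/-- Needed for `m = 0`, which gives continuity at every nonzero vector from `C²`, and for `m = ∞` at
regular vectors. -/
theorem contDiffAt_dualNormForm {m : WithTop ℕ∞} {z : Coord n × Coord n}
    (h : ContDiffAt ℝ (m + 2) (fun z : Coord n × Coord n => f z.1 z.2) z)
    (hdet : (gMat f z.1 z.2).det ≠ 0) (ha : ContDiffAt ℝ (m + 1) a z.1) :
    ContDiffAt ℝ m (fun z : Coord n × Coord n => dualNormForm f a z.1 z.2) z := by
  refine ((h.of_le le_self_add).pow 2).mul
    (ContDiffAt.sum fun l _ => ContDiffAt.sum fun k _ => ?_)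
  have h1 : ∀ i, ContDiffAt ℝ m (fun z : Coord n × Coord n => pd i a z.1) z := fun i =>
    (contDiffAt_pd ha le_rfl i).comp z contDiffAt_fst
  exact ((contDiffAt_matrix_inv (contDiffAt_gMat h) hdet l k).mul (h1 l)).mul (h1 k)

namespace IsContractedInvariantAt

theorem det_ne_zero (H : IsContractedInvariantAt f a x) {y : Coord n} (hy : y ≠ 0) :
    (gMat f x y).det ≠ 0 :=
  (H.posDef y hy).det_pos.ne'

theorem gMat_smul (H : IsContractedInvariantAt f a x) {y : Coord n} (hy : y ≠ 0) {t : ℝ}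
    (ht : 0 < t) : gMat f x (t • y) = gMat f x y := by
  ext i j
  rw [gMat_apply (contDiffAt_slice (H.contDiffAt_two y hy)),
    gMat_apply (contDiffAt_slice (H.contDiffAt_two _ (smul_ne_zero ht.ne' hy))),
    fderiv_fderiv_smul_of_homogeneous_two (energy_homogeneous H.homogeneous) hy ht]

theorem dualNormForm_smul (H : IsContractedInvariantAt f a x) {y : Coord n} (hy : y ≠ 0) {t : ℝ}
    (ht : 0 < t) : dualNormForm f a x (t • y) = t ^ 2 * dualNormForm f a x y := by
  rw [dualNormForm, H.gMat_smul hy ht, H.homogeneous y t ht, dualNormForm]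
  ring

/-- Contracting the change of the spray with `aₗ` gives `(aₘyᵐ)² - E gˡᵐaₗaₘ`, the function
differentiated here, and the mixed curvature is minus the third `y`-derivative of the spray. -/
theorem pd_pd_pd_eq_zero (H : IsContractedInvariantAt f a x) {y : Coord n} (hy : y ≠ 0)
    (hreg : ContDiffAt ℝ ∞ (fun z : Coord n × Coord n => f z.1 z.2) (x, y))
    (hinv : ∀ i j k, ∑ l, berwaldP (fun x y => Real.exp (a x) * f x y) l i j k x y * pd l a x
        = ∑ l, berwaldP f l i j k x y * pd l a x) (i j k : Fin n) :
    pd k (pd j (pd i fun y =>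
      (∑ m, pd m a x * y m) ^ 2 - 1 / 2 * dualNormForm f a x y)) y = 0 := by
  have hdet := H.det_ne_zero hy
  have hreg2 : ContDiffAt ℝ (∞ + 2) (fun z : Coord n × Coord n => f z.1 z.2) (x, y) := hreg
  have hcomp : ∀ {φ : Coord n × Coord n → ℝ}, ContDiffAt ℝ ∞ φ (x, y) →
      ContDiffAt ℝ ∞ (fun y' => φ (x, y')) y := fun h =>
    h.comp y (f := fun y' => (x, y')) (by fun_prop)
  have hspray : ∀ l, ContDiffAt ℝ ∞ (fun y' => spray f l x y') y := fun l =>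
    hcomp (contDiffAt_spray hreg2 hdet l)
  set D : Fin n → Coord n → ℝ := fun l y => (∑ k, pd k a x * y k) * y l
        - energy f x y * ∑ m, (gMat f x y)⁻¹ l m * pd m a x with hD
  have hDsmooth : ∀ l, ContDiffAt ℝ ∞ (D l) y := by
    intro l
    refine ContDiffAt.sub (by fun_prop) ?_
    refine (contDiffAt_energy_slice (contDiffAt_slice hreg)).mul (ContDiffAt.sum fun m _ => ?_)
    exact (hcomp (contDiffAt_matrix_inv (contDiffAt_gMat hreg2) hdet l m)).mul contDiffAt_const
  have hconf : ∀ l, (fun y' => spray (fun x y => Real.exp (a x) * f x y) l x y') =ᶠ[𝓝 y]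
      fun y' => spray f l x y' + D l y' := by
    intro l
    filter_upwards [isOpen_ne.mem_nhds hy] with y' hy'
    exact spray_exp_mul (H.contDiffAt_two y' hy') hy' H.homogeneous (H.det_ne_zero hy')
      (H.contDiffAt_factor.differentiableAt (by simp)) l
  have hP : ∀ l, berwaldP (fun x y => Real.exp (a x) * f x y) l i j k x y
      = berwaldP f l i j k x y - pd k (pd j (pd i (D l))) y := by
    intro l
    have h1 := ((((hconf l).pd_eventuallyEq i).pd_eventuallyEq j).pd_eventuallyEq k).self_of_nhds
    have h2 := pd_pd_pd_add (hspray l) (hDsmooth l) i j k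
    have h3 : berwaldP (fun x y => Real.exp (a x) * f x y) l i j k x y
        = - (pd k (pd j (pd i fun y' => spray (fun x y => Real.exp (a x) * f x y) l x y')) y) := rfl
    have h4 : berwaldP f l i j k x y = - (pd k (pd j (pd i fun y' => spray f l x y')) y) := rfl
    rw [h3, h4, h1, h2]
    ring
  have hsum := hinv i j k
  simp only [hP, sub_mul, Finset.sum_sub_distrib] at hsum
  have hzero : ∑ l, pd k (pd j (pd i (D l))) y * pd l a x = 0 := by linarith
  rw [← pd_pd_pd_sum_mul hDsmooth] at hzero
  rw [← hzero]
  congr 4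
  ext y'
  simp only [hD, dualNormForm, energy, sub_mul, Finset.sum_sub_distrib, pow_two (∑ m, _)]
  congr 1
  · rw [Finset.mul_sum]
    exact Finset.sum_congr rfl fun l _ => by ring
  · rw [← mul_assoc, Finset.mul_sum]
    refine Finset.sum_congr rfl fun l _ => ?_
    simp only [Finset.mul_sum, Finset.sum_mul]
    exact Finset.sum_congr rfl fun m _ => by ring

/-- A line has codimension at least two, so one quadratic form works on its whole complement; the
line itself is reached by density, as `F²|da|²` is continuous at all nonzero vectors. -/
theorem exists_matrixForm_eq (hn : 3 ≤ n) (H : IsContractedInvariantAt f a x) :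
    ∃ c : Matrix (Fin n) (Fin n) ℝ, c.IsSymm ∧
      ∀ y, y ≠ 0 → dualNormForm f a x y = matrixForm c y y := by
  obtain ⟨d, hd⟩ := H.invariant
  set L : Submodule ℝ (Coord n) := Submodule.span ℝ {d} with hL
  have hrank : Module.finrank ℝ L ≤ 1 := (finrank_span_le_card ({d} : Set (Coord n))).trans (by simp)
  have hquot : 1 < Module.finrank ℝ (Coord n ⧸ L) := by
    have h1 := Submodule.finrank_quotient_add_finrank L
    rw [finrank_euclideanSpace_fin] at h1
    omega
  have hopen : IsOpen ((L : Set (Coord n))ᶜ) := (Submodule.closed_of_finiteDimensional L).isOpen_compl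
  have hconn : IsPreconnected ((L : Set (Coord n))ᶜ) :=
    (isConnected_compl_of_one_lt_codim (Module.lt_rank_of_lt_finrank hquot)).isPreconnected
  have h0 : (0 : Coord n) ∉ ((L : Set (Coord n))ᶜ) := by simp
  have hne : ∀ y ∈ ((L : Set (Coord n))ᶜ), y ≠ 0 := fun y hy h => h0 (h ▸ hy)
  have hcont : ∀ y, y ≠ 0 → ContinuousAt (dualNormForm f a x) y := by
    intro y hy
    have h1 : ContDiffAt ℝ 0 (fun z : Coord n × Coord n => dualNormForm f a z.1 z.2) (x, y) :=
      contDiffAt_dualNormForm (by simpa using H.contDiffAt_two y hy) (H.det_ne_zero hy)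
        (H.contDiffAt_factor.of_le (by simp))
    exact ContinuousAt.comp (f := fun y' => (x, y')) h1.continuousAt (by fun_prop)
  obtain ⟨c, hc⟩ := exists_quadratic_of_pd_pd_pd_eq_zero hopen hconn h0
    (R := fun y => (∑ m, pd m a x * y m) ^ 2 - 1 / 2 * dualNormForm f a x y)
    (by
      intro y hy
      have h1 : ContDiffAt ℝ ∞ (fun z : Coord n × Coord n => dualNormForm f a z.1 z.2) (x, y) :=
        contDiffAt_dualNormForm (hd y hy).1 (H.det_ne_zero (hne y hy)) H.contDiffAt_factor
      have h2 : ContDiffAt ℝ ∞ (dualNormForm f a x) y :=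
        h1.comp y (f := fun y' => (x, y')) (by fun_prop)
      exact ContDiffAt.sub (by fun_prop) (contDiffAt_const.mul h2))
    (by
      intro y hy t ht
      have : ∑ m, pd m a x * (t • y) m = t * ∑ m, pd m a x * y m := by
        rw [Finset.mul_sum]
        exact Finset.sum_congr rfl fun m _ => by simp; ring
      simp only [this, H.dualNormForm_smul hy ht]
      ring)
    (by
      intro y hy i j k
      exact H.pd_pd_pd_eq_zero (hne y hy) (hd y hy).1 (hd y hy).2 i j k)
  -- Solves `(aₘyᵐ)² - ½F²|da|² = cᵢⱼyⁱyʲ` for `F²|da|²`, with `c` symmetrized.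
  set C : Matrix (Fin n) (Fin n) ℝ := Matrix.of fun i j =>
    2 * (pd i a x * pd j a x) - (c i j + c j i) with hC
  have hCsymm : C.IsSymm := by
    ext i j
    simp only [hC, Matrix.transpose_apply, Matrix.of_apply]
    ring
  have hform : ∀ y ∈ ((L : Set (Coord n))ᶜ), dualNormForm f a x y = matrixForm C y y := by
    intro y hy
    have h1 := hc y hy
    have h2 : ∑ i, ∑ j, c j i * y i * y j = ∑ i, ∑ j, c i j * y i * y j := by
      rw [Finset.sum_comm]
      exact Finset.sum_congr rfl fun i _ => Finset.sum_congr rfl fun j _ => by ring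
    have h3 : (∑ m, pd m a x * y m) ^ 2 = ∑ i, ∑ j, pd i a x * pd j a x * y i * y j := by
      rw [pow_two, Finset.sum_mul_sum]
      exact Finset.sum_congr rfl fun i _ => Finset.sum_congr rfl fun j _ => by ring
    have h4 : matrixForm C y y = 2 * (∑ i, ∑ j, pd i a x * pd j a x * y i * y j)
        - (∑ i, ∑ j, c i j * y i * y j + ∑ i, ∑ j, c j i * y i * y j) := by
      simp only [matrixForm_apply, hC, Matrix.of_apply, Finset.mul_sum, ← Finset.sum_add_distrib,
        ← Finset.sum_sub_distrib]
      exact Finset.sum_congr rfl fun i _ => Finset.sum_congr rfl fun j _ => by ring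
    rw [h4, h2, ← h3]
    linarith
  refine ⟨C, hCsymm, fun y hy => ?_⟩
  have hdense : Dense ((L : Set (Coord n))ᶜ) := by
    rw [← interior_eq_empty_iff_dense_compl]
    by_contra h
    have h1 := L.eq_top_of_nonempty_interior' (Set.nonempty_iff_ne_empty.2 h)
    rw [h1, finrank_top, finrank_euclideanSpace_fin] at hrank
    omega
  have hbot : (𝓝[(L : Set (Coord n))ᶜ] y).NeBot := mem_closure_iff_nhdsWithin_neBot.1 (hdense y)
  have hcont2 : Continuous fun y => matrixForm C y y := by
    simp only [matrixForm_apply]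
    fun_prop
  refine tendsto_nhds_unique (l := 𝓝[(L : Set (Coord n))ᶜ] y)
    ((hcont y hy).tendsto.mono_left nhdsWithin_le_nhds) ?_
  refine (hcont2.continuousAt.tendsto.mono_left nhdsWithin_le_nhds).congr' ?_
  filter_upwards [self_mem_nhdsWithin] with z hz
  exact (hform z hz).symm

theorem hasQuadraticDualNorm (H : IsContractedInvariantAt f a x) (hη : fderiv ℝ a x ≠ 0)
    {c : Matrix (Fin n) (Fin n) ℝ} (hc : c.IsSymm)
    (hform : ∀ y, y ≠ 0 → dualNormForm f a x y = matrixForm c y y) :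
    HasQuadraticDualNorm (f x) (fderiv ℝ a x) (matrixForm c) where
  nonneg := H.nonneg
  homogeneous := H.homogeneous
  contDiffAt y hy := contDiffAt_slice (H.contDiffAt_two y hy)
  posDef y hy X hX := by
    have h1 := hessian_eq_sum_gMat (contDiffAt_slice (H.contDiffAt_two y hy)) X X
    have h2 := (H.posDef y hy).dotProduct_mulVec_pos (x := fun i => X i)
      (fun h => hX (by ext i; exact congrFun h i))
    have h3 : fderiv ℝ (fderiv ℝ fun z => 1 / 2 * f x z ^ 2) y X X
        = fderiv ℝ (fderiv ℝ (energy f x)) y X X := rfl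
    rw [h3, h1]
    refine h2.trans_eq ?_
    simp only [dotProduct, Matrix.mulVec, Pi.star_apply, star_trivial, Finset.mul_sum]
    exact Finset.sum_congr rfl fun i _ => Finset.sum_congr rfl fun j _ => by ring
  ne_zero := hη
  symm := matrixForm_symm hc
  quadratic y hy := by
    have h2 := contDiffAt_slice (H.contDiffAt_two y hy)
    have hsymm : (gMat f x y).transpose = gMat f x y := by
      ext i j
      rw [Matrix.transpose_apply, gMat_apply h2, gMat_apply h2]
      exact ((contDiffAt_energy_slice h2).isSymmSndFDerivAt (by simp)).eq _ _
    have hsolve : (gMat f x y).mulVec ((gMat f x y)⁻¹.mulVec fun m => pd m a x)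
        = fun m => pd m a x := by
      rw [Matrix.mulVec_mulVec, Matrix.mul_nonsing_inv _
        (isUnit_iff_ne_zero.2 (H.det_ne_zero hy)), Matrix.one_mulVec]
    refine ⟨WithLp.toLp 2 ((gMat f x y)⁻¹.mulVec fun m => pd m a x), fun X => ?_, ?_⟩
    · have h1 := hessian_eq_sum_gMat h2
        (WithLp.toLp 2 ((gMat f x y)⁻¹.mulVec fun m => pd m a x)) X
      refine h1.trans ?_
      rw [fderiv_apply_eq_sum_pd, Finset.sum_comm]
      refine Finset.sum_congr rfl fun j _ => ?_
      rw [← Finset.sum_mul]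
      congr 1
      rw [← congrFun hsolve j]
      simp only [Matrix.mulVec, dotProduct]
      refine Finset.sum_congr rfl fun i _ => ?_
      rw [← congrFun (congrFun hsymm i) j]
      rfl
    · rw [← hform y hy, dualNormForm, fderiv_apply_eq_sum_pd]
      congr 1
      refine Finset.sum_congr rfl fun l _ => ?_
      simp only [Matrix.mulVec, dotProduct, Finset.mul_sum]
      exact Finset.sum_congr rfl fun m _ => by ring

end IsContractedInvariantAt

end FinslerConformal

namespace FinslerConformal

/-! ### Smooth dependence on the base point -/

variable {n : ℕ}

theorem matrixForm_eq_dotProduct (c : Matrix (Fin n) (Fin n) ℝ) (v w : Coord n) :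
    matrixForm c v w = ∑ i, v i * c.mulVec (fun j => w j) i := by
  simp only [matrixForm_apply, Matrix.mulVec, dotProduct, Finset.mul_sum]
  exact Finset.sum_congr rfl fun i _ => Finset.sum_congr rfl fun j _ => by ring

theorem det_ne_zero_of_matrixForm_pos {c : Matrix (Fin n) (Fin n) ℝ}
    (h : ∀ y, y ≠ 0 → 0 < matrixForm c y y) : c.det ≠ 0 := by
  intro h0
  obtain ⟨v, hv, hcv⟩ := Matrix.exists_mulVec_eq_zero_iff.2 h0
  have h1 := h (WithLp.toLp 2 v) (fun h => hv (by simpa using congrArg WithLp.ofLp h))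
  rw [matrixForm_eq_dotProduct] at h1
  simp [hcv] at h1

/-- The vector dual to the differential of `a` with respect to `matrixForm c`. -/
def dualVector (c : Matrix (Fin n) (Fin n) ℝ) (a : Coord n → ℝ) (x : Coord n) : Coord n :=
  WithLp.toLp 2 (c⁻¹.mulVec fun m => pd m a x)

theorem matrixForm_dualVector {c : Matrix (Fin n) (Fin n) ℝ} (hc : c.IsSymm) (hdet : c.det ≠ 0)
    (a : Coord n → ℝ) (x v : Coord n) : matrixForm c (dualVector c a x) v = fderiv ℝ a x v := by
  rw [matrixForm_symm hc, matrixForm_eq_dotProduct, fderiv_apply_eq_sum_pd]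
  have : c.mulVec (c⁻¹.mulVec fun m => pd m a x) = fun m => pd m a x := by
    rw [Matrix.mulVec_mulVec, Matrix.mul_nonsing_inv _ (isUnit_iff_ne_zero.2 hdet),
      Matrix.one_mulVec]
  refine Finset.sum_congr rfl fun i _ => ?_
  rw [mul_comm]
  congr 1
  exact congrFun this i

theorem contDiffAt_matrixForm {m : WithTop ℕ∞} {W : Type*} [NormedAddCommGroup W] [NormedSpace ℝ W]
    {c : W → Matrix (Fin n) (Fin n) ℝ} {v w : W → Coord n} {z : W}
    (hc : ∀ i j, ContDiffAt ℝ m (fun z => c z i j) z) (hv : ContDiffAt ℝ m v z)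
    (hw : ContDiffAt ℝ m w z) : ContDiffAt ℝ m (fun z => matrixForm (c z) (v z) (w z)) z := by
  simp only [matrixForm_apply]
  refine ContDiffAt.sum fun i _ => ContDiffAt.sum fun j _ => ((hc i j).mul ?_).mul ?_
  · exact contDiffAt_piLp 2 |>.1 hv i
  · exact contDiffAt_piLp 2 |>.1 hw j

variable {f : Coord n → Coord n → ℝ} {a : Coord n → ℝ} {x₀ v₀ : Coord n}

/-- The coefficients of the quadratic form `F² |da|²` depend smoothly on the base point. -/
theorem eventually_contDiffAt_coeff {c : Coord n → Matrix (Fin n) (Fin n) ℝ}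
    (hc : ∀ x, IsContractedInvariantAt f a x → (c x).IsSymm ∧
      ∀ y, y ≠ 0 → dualNormForm f a x y = matrixForm (c x) y y)
    (H : ∀ᶠ x in 𝓝 x₀, IsContractedInvariantAt f a x) (hv₀ : v₀ ≠ 0)
    (hreg : ∀ᶠ z in 𝓝 (x₀, v₀), ContDiffAt ℝ ∞ (fun z : Coord n × Coord n => f z.1 z.2) z) :
    ∀ᶠ x in 𝓝 x₀, ∀ i j, ContDiffAt ℝ ∞ (fun x => c x i j) x := by
  have hne : ∀ᶠ z in 𝓝 (x₀, v₀), (z : Coord n × Coord n).2 ≠ 0 :=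
    (isOpen_ne.preimage continuous_snd).mem_nhds hv₀
  obtain ⟨pa, hpa, pb, hpb, hpab⟩ := Filter.eventually_prod_iff.1
    (nhds_prod_eq (x := x₀) (y := v₀) ▸ (hreg.and hne))
  have hsmall : ∀ᶠ t in 𝓝 (0 : ℝ), ∀ i j, pb (v₀ + t • EuclideanSpace.single i 1) ∧
      pb (v₀ + t • (EuclideanSpace.single i 1 + EuclideanSpace.single j 1)) := by
    rw [Filter.eventually_all]
    intro i
    rw [Filter.eventually_all]
    intro j
    exact ((tendsto_line v₀ _).eventually hpb).and ((tendsto_line v₀ _).eventually hpb)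
  -- A positive `t` small enough that all polarization vectors stay near `v₀`, where `f` is smooth;
  -- the basis vectors themselves may be singular.
  obtain ⟨t, ht, htpos⟩ := ((hsmall.filter_mono nhdsWithin_le_nhds).and
    (self_mem_nhdsWithin : Set.Ioi (0 : ℝ) ∈ 𝓝[>] 0)).exists
  have htpos : 0 < t := htpos
  -- Polarization as a mixed second difference based at `v₀`. The matrices `c x` were chosen point
  -- by point, so their smoothness has to come from such a formula.
  have hformula : ∀ x, IsContractedInvariantAt f a x → pa x → ∀ i j, c x i j = 1 / (2 * t ^ 2) *
      (dualNormForm f a x (v₀ + t • (EuclideanSpace.single i 1 + EuclideanSpace.single j 1))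
        - dualNormForm f a x (v₀ + t • EuclideanSpace.single i 1)
        - dualNormForm f a x (v₀ + t • EuclideanSpace.single j 1) + dualNormForm f a x v₀) := by
    intro x hx hpx i j
    obtain ⟨hsymm, hform⟩ := hc x hx
    rw [hform _ (hpab hpx (ht i j).2).2, hform _ (hpab hpx (ht i j).1).2,
      hform _ (hpab hpx (ht j i).1).2, hform _ hv₀]
    simp only [map_add, map_smul, LinearMap.add_apply, LinearMap.smul_apply, smul_eq_mul,
      matrixForm_symm hsymm _ v₀,
      matrixForm_symm hsymm (EuclideanSpace.single j 1) (EuclideanSpace.single i 1)]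
    rw [← matrixForm_single (c x) i j]
    field_simp
    ring
  have hsmooth : ∀ x y, IsContractedInvariantAt f a x → pa x → pb y →
      ContDiffAt ℝ ∞ (fun x => dualNormForm f a x y) x := by
    intro x y hx hpx hpy
    obtain ⟨h1, h2⟩ := hpab hpx hpy
    have h3 : ContDiffAt ℝ ∞ (fun z : Coord n × Coord n => dualNormForm f a z.1 z.2) (x, y) :=
      contDiffAt_dualNormForm h1 (hx.det_ne_zero h2) hx.contDiffAt_factor
    exact h3.comp x (f := fun x' => (x', y)) (by fun_prop)
  filter_upwards [(H.and hpa).eventually_nhds] with x hx i j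
  obtain ⟨hHx, hpx⟩ := hx.self_of_nhds
  have hpv : pb v₀ := hpb.self_of_nhds
  refine ContDiffAt.congr_of_eventuallyEq ?_ (hx.mono fun x' hx' => hformula x' hx'.1 hx'.2 i j)
  exact contDiffAt_const.mul ((((hsmooth x _ hHx hpx (ht i j).2).sub
    (hsmooth x _ hHx hpx (ht i j).1)).sub (hsmooth x _ hHx hpx (ht j i).1)).add
    (hsmooth x _ hHx hpx hpv))

/-- The Finsleroid parameters of a norm are determined by its value and its axial derivative at a
vector annihilated by the covector. -/
theorem HasQuadraticDualNorm.parameters_eq {V : Type*} [NormedAddCommGroup V] [NormedSpace ℝ V]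
    {F : V → ℝ} {η : V →L[ℝ] ℝ} {A : LinearMap.BilinForm ℝ V} (H : HasQuadraticDualNorm F η A)
    {g ρ : ℝ} (hg : -2 < g ∧ g < 2)
    (hF : ∀ y, F y = Real.exp ρ * finsleroidFun g (η y) (√(A y y - η y ^ 2)))
    {w v : V} (hw : ∀ u, A w u = η u) (hw1 : η w = 1) (hv : v ≠ 0) (hηv : η v = 0) :
    g = √(A v v) * fderiv ℝ F v w / F v ∧
      ρ = Real.log (F v / √(A v v)) - g / √(1 - g ^ 2 / 4) *
        Real.arctan (g / √(1 - g ^ 2 / 4) / 2) / 2 := by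
  have hApos := H.form_pos hv
  have hqpos : 0 < √(A v v) := Real.sqrt_pos.2 hApos
  have hFpos := H.pos hv
  constructor
  · have h1 : HasDerivAt (fun t : ℝ => 1 / 2 * F (v + t • w) ^ 2) (F v * fderiv ℝ F v w) 0 := by
      have hd : HasFDerivAt F (fderiv ℝ F v) (v + (0 : ℝ) • w) := by
        simpa using ((H.contDiffAt v hv).differentiableAt (by norm_num)).hasFDerivAt
      have h2 : HasDerivAt (fun t : ℝ => F (v + t • w)) (fderiv ℝ F v w) 0 :=
        hd.comp_hasDerivAt (0 : ℝ) (hasDerivAt_line v w 0)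
      refine ((h2.pow 2).const_mul (1 / 2)).congr_deriv ?_
      simp
      ring
    have h2 : HasDerivAt (fun t : ℝ => Real.exp ρ ^ 2 *
        (1 / 2 * finsleroidFun g t (√(A v v)) ^ 2)) _ 0 :=
      (hasDerivAt_half_finsleroidFun_sq hg (hasDerivAt_id (0 : ℝ))
        (hasDerivAt_const (0 : ℝ) (√(A v v))) hqpos).const_mul _
    -- Along `v + t w` one has `η = t`, while `A - η²` keeps the value `A(v, v)`; so only the first
    -- argument of the Finsleroid moves, and the derivative at `t = 0` isolates `g`.
    have h3 : (fun t : ℝ => 1 / 2 * F (v + t • w) ^ 2) = fun t : ℝ => Real.exp ρ ^ 2 *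
        (1 / 2 * finsleroidFun g t (√(A v v)) ^ 2) := by
      ext t
      have e1 : η (v + t • w) = t := by simp [hηv, hw1]
      have e2 : A (v + t • w) (v + t • w) - t ^ 2 = A v v := by
        simp only [map_add, map_smul, LinearMap.add_apply, LinearMap.smul_apply, smul_eq_mul,
          H.symm v w, hw, hηv, hw1]
        ring
      rw [hF, e1, e2]
      ring
    rw [h3] at h1
    have h4 := h1.unique h2
    have h5 : F v ^ 2 = Real.exp ρ ^ 2 * (√(A v v) ^ 2 * finsleroidFactor g 0 (√(A v v))) := by
      rw [hF v, hηv, mul_pow, zero_pow two_ne_zero, sub_zero, finsleroidFun_sq hg _ hqpos]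
      ring
    simp only [id, zero_add, mul_zero, add_zero, mul_one] at h4
    rw [eq_div_iff hFpos.ne']
    have h6 : F v * (g * F v) = F v * (√(A v v) * fderiv ℝ F v w) := by
      calc F v * (g * F v) = g * F v ^ 2 := by ring
        _ = √(A v v) * (F v * fderiv ℝ F v w) := by rw [h5, h4]; ring
        _ = _ := by ring
    exact mul_left_cancel₀ hFpos.ne' h6
  · have h1 : F v / √(A v v) = Real.exp (ρ + g / √(1 - g ^ 2 / 4) *
        Real.arctan (g / √(1 - g ^ 2 / 4) / 2) / 2) := by
      rw [div_eq_iff hqpos.ne', hF v, hηv, Real.exp_add]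
      simp only [finsleroidFun, finsleroidAngle, lt_irrefl, if_false, zero_pow two_ne_zero,
        sub_zero, mul_zero, zero_add, Real.sqrt_sq hqpos.le]
      ring
    rw [h1, Real.log_exp]
    ring

/-- Smooth Finsleroid data near `x₀`. -/
theorem exists_smooth_finsleroid_data (hn : 3 ≤ n)
    (H : ∀ᶠ x in 𝓝 x₀, IsContractedInvariantAt f a x) (hη : ∀ᶠ x in 𝓝 x₀, fderiv ℝ a x ≠ 0)
    (hv₀ : v₀ ≠ 0) (hηv₀ : fderiv ℝ a x₀ v₀ = 0)
    (hreg : ∀ᶠ z in 𝓝 (x₀, v₀), ContDiffAt ℝ ∞ (fun z : Coord n × Coord n => f z.1 z.2) z) :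
    ∃ (c : Coord n → Matrix (Fin n) (Fin n) ℝ) (g ρ : Coord n → ℝ), ∀ᶠ x in 𝓝 x₀,
      (∀ i j, ContDiffAt ℝ ∞ (fun x => c x i j) x) ∧ ContDiffAt ℝ ∞ g x ∧ ContDiffAt ℝ ∞ ρ x ∧
      ContDiffAt ℝ ∞ a x ∧
      HasQuadraticDualNorm (f x) (fderiv ℝ a x) (matrixForm (c x)) ∧ (-2 < g x ∧ g x < 2) ∧
      ∀ y, f x y = Real.exp (ρ x) * finsleroidFun (g x) (fderiv ℝ a x y)
        (√(matrixForm (c x) y y - fderiv ℝ a x y ^ 2)) := by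
  have hex : ∀ x, ∃ c : Matrix (Fin n) (Fin n) ℝ, IsContractedInvariantAt f a x → c.IsSymm ∧
      ∀ y, y ≠ 0 → dualNormForm f a x y = matrixForm c y y := by
    intro x
    by_cases hx : IsContractedInvariantAt f a x
    · obtain ⟨c, hc⟩ := hx.exists_matrixForm_eq hn
      exact ⟨c, fun _ => hc⟩
    · exact ⟨0, fun h => absurd h hx⟩
  choose c hc using hex
  have hcsmooth := eventually_contDiffAt_coeff hc H hv₀ hreg
  have hQ : ∀ᶠ x in 𝓝 x₀, HasQuadraticDualNorm (f x) (fderiv ℝ a x) (matrixForm (c x)) := by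
    filter_upwards [H, hη] with x hx hηx
    exact hx.hasQuadraticDualNorm hηx (hc x hx).1 (hc x hx).2
  set w : Coord n → Coord n := fun x => dualVector (c x) a x with hw
  -- The projection of `v₀` to `ker da` along `w`; it equals `v₀` at `x₀`, so it remains a regular
  -- vector nearby.
  set v : Coord n → Coord n := fun x => v₀ - fderiv ℝ a x v₀ • w x with hv
  -- The formulas of `parameters_eq`, with the derivative of `f` taken on the product so that
  -- smoothness in `x` is visible.
  set g : Coord n → ℝ := fun x =>
    √(matrixForm (c x) (v x) (v x)) *
      fderiv ℝ (fun z : Coord n × Coord n => f z.1 z.2) (x, v x) (0, w x) / f x (v x) with hg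
  set G : Coord n → ℝ := fun x => g x / √(1 - g x ^ 2 / 4) with hG
  set ρ : Coord n → ℝ := fun x => Real.log (f x (v x) / √(matrixForm (c x) (v x) (v x)))
    - G x * Real.arctan (G x / 2) / 2 with hρ
  have hda : ∀ x, ContDiffAt ℝ ∞ a x → ContDiffAt ℝ ∞ (fun x => fderiv ℝ a x) x := fun x hx =>
    hx.fderiv_right (by exact_mod_cast le_rfl)
  have hdual : ∀ x, HasQuadraticDualNorm (f x) (fderiv ℝ a x) (matrixForm (c x)) →
      IsContractedInvariantAt f a x →
      (c x).det ≠ 0 ∧ (∀ u, matrixForm (c x) (w x) u = fderiv ℝ a x u) ∧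
        fderiv ℝ a x (w x) = 1 := by
    intro x hx hx'
    have hdet := det_ne_zero_of_matrixForm_pos fun y hy => hx.form_pos hy
    have h1 : ∀ u, matrixForm (c x) (w x) u = fderiv ℝ a x u :=
      matrixForm_dualVector (hc x hx').1 hdet a x
    obtain ⟨w', hw', hw1'⟩ := hx.exists_dual_vector
    have h2 : w x = w' := by
      by_contra hne
      have h3 := hx.form_pos (sub_ne_zero.2 hne)
      rw [LinearMap.map_sub₂, h1, hw', sub_self] at h3
      exact lt_irrefl _ h3
    exact ⟨hdet, h1, h2 ▸ hw1'⟩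
  have hwsmooth : ∀ᶠ x in 𝓝 x₀, ContDiffAt ℝ ∞ w x := by
    filter_upwards [hcsmooth, hQ, H] with x h1 h2 h3
    refine (contDiffAt_piLp 2).2 fun i => ?_
    simp only [hw, dualVector, Matrix.mulVec, dotProduct]
    exact ContDiffAt.sum fun j _ => (contDiffAt_matrix_inv h1 (hdual x h2 h3).1 i j).mul
      (contDiffAt_pd_infty h3.contDiffAt_factor j)
  have hvsmooth : ∀ᶠ x in 𝓝 x₀, ContDiffAt ℝ ∞ v x := by
    filter_upwards [hwsmooth, H] with x h1 h2
    exact contDiffAt_const.sub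
      (((hda x h2.contDiffAt_factor).clm_apply contDiffAt_const).smul h1)
  have hvx₀ : v x₀ = v₀ := by simp [hv, hηv₀]
  have hgood : ∀ᶠ x in 𝓝 x₀, ContDiffAt ℝ ∞ (fun z : Coord n × Coord n => f z.1 z.2) (x, v x) ∧
      v x ≠ 0 := by
    have h1 : ContinuousAt (fun x => (x, v x)) x₀ :=
      continuousAt_id.prodMk hvsmooth.self_of_nhds.continuousAt
    have h2 : Filter.Tendsto (fun x => (x, v x)) (𝓝 x₀) (𝓝 (x₀, v₀)) := by
      have := h1.tendsto
      rwa [hvx₀] at this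
    have hne : ∀ᶠ z in 𝓝 (x₀, v₀), (z : Coord n × Coord n).2 ≠ 0 :=
      (isOpen_ne.preimage continuous_snd).mem_nhds hv₀
    exact h2.eventually (hreg.and hne)
  have hparam : ∀ᶠ x in 𝓝 x₀, (-2 < g x ∧ g x < 2) ∧
      ∀ y, f x y = Real.exp (ρ x) * finsleroidFun (g x) (fderiv ℝ a x y)
        (√(matrixForm (c x) y y - fderiv ℝ a x y ^ 2)) := by
    filter_upwards [hQ, H, hgood] with x h1 h2 h3
    obtain ⟨-, hwx, hw1⟩ := hdual x h1 h2
    obtain ⟨g', ρ', hg', hF⟩ := h1.exists_eq_finsleroid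
    have hηv : fderiv ℝ a x (v x) = 0 := by simp [hv, hw1]
    obtain ⟨e1, e2⟩ := h1.parameters_eq hg' hF hwx hw1 h3.2 hηv
    have hd : fderiv ℝ (f x) (v x) (w x)
        = fderiv ℝ (fun z : Coord n × Coord n => f z.1 z.2) (x, v x) (0, w x) := by
      have h4 : HasFDerivAt (fun y' => f x y') _ (v x) :=
        (h3.1.differentiableAt (by simp)).hasFDerivAt.comp (v x) (hasFDerivAt_prodMk_right x (v x))
      have h5 := h4.fderiv
      change fderiv ℝ (f x) (v x) = _ at h5
      rw [h5]
      simp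
    have hgx : g' = g x := by rw [e1, hd]
    have hρx : ρ' = ρ x := by rw [e2, hgx]
    subst hgx
    exact ⟨hg', by rw [← hρx]; exact hF⟩
  refine ⟨c, g, ρ, ?_⟩
  filter_upwards [hcsmooth, hQ, H, hwsmooth, hvsmooth, hgood, hparam] with x h1 h2 h3 h4 h5 h6 h7
  have hform : ContDiffAt ℝ ∞ (fun x => √(matrixForm (c x) (v x) (v x))) x :=
    (contDiffAt_matrixForm h1 h5 h5).sqrt (h2.form_pos h6.2).ne'
  have hpair : ContDiffAt ℝ ∞ (fun x => (x, v x)) x := contDiffAt_id.prodMk h5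
  have hfv : ContDiffAt ℝ ∞ (fun x => f x (v x)) x :=
    ContDiffAt.comp x (g := fun z : Coord n × Coord n => f z.1 z.2) h6.1 hpair
  have hfpos := h2.pos h6.2
  have hgs : ContDiffAt ℝ ∞ g x := by
    refine (hform.mul ?_).div hfv hfpos.ne'
    refine ContDiffAt.clm_apply ?_ (contDiffAt_const.prodMk h4)
    exact ContDiffAt.comp x (h6.1.fderiv_right (m := ∞) (by exact_mod_cast le_rfl)) hpair
  have hGs : ContDiffAt ℝ ∞ G x := by
    have hpos := one_sub_sq_div_four_pos h7.1
    refine hgs.div ?_ (Real.sqrt_pos.2 hpos).ne'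
    exact (contDiffAt_const.sub ((hgs.pow 2).div_const _)).sqrt hpos.ne'
  refine ⟨h1, hgs, ?_, h3.contDiffAt_factor, h2, h7⟩
  have hqpos : 0 < √(matrixForm (c x) (v x) (v x)) := Real.sqrt_pos.2 (h2.form_pos h6.2)
  refine ((hfv.div hform hqpos.ne').log (div_pos hfpos hqpos).ne').sub ?_
  exact (hGs.mul (Real.contDiff_arctan.contDiffAt.comp x (hGs.div_const 2))).div_const 2

end FinslerConformal

namespace FinslerConformal

/-! ### Induced coordinates on the tangent bundle -/

variable {n : ℕ} {M : Type*} [TopologicalSpace M] [ChartedSpace (Coord n) M]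

theorem contMDiff_mk_tangentBundle :
    ContMDiff 𝓘(ℝ, Coord n × Coord n) (𝓡 n).tangent ∞
      (fun z : Coord n × Coord n => (⟨z.1, z.2⟩ : TangentBundle (𝓡 n) (Coord n))) := by
  rw [modelWithCornersSelf_prod]
  exact contMDiff_tangentBundleModelSpaceHomeomorph_symm (I := 𝓡 n)

theorem contMDiff_toProd_tangentBundle :
    ContMDiff (𝓡 n).tangent 𝓘(ℝ, Coord n × Coord n) ∞
      (fun v : TangentBundle (𝓡 n) (Coord n) => ((v.proj, v.snd) : Coord n × Coord n)) := by
  rw [modelWithCornersSelf_prod]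
  exact contMDiff_tangentBundleModelSpaceHomeomorph (I := 𝓡 n)

variable {e : OpenPartialHomeomorph M (Coord n)}

/-- In product coordinates `vec` is the tangent map of the smooth map `e.symm`, and on the open
target this agrees with the tangent map within the target. -/
theorem contMDiffAt_vec [IsManifold (𝓡 n) ∞ M] (he : e ∈ IsManifold.maximalAtlas (𝓡 n) ∞ M) {x : Coord n}
    (hx : x ∈ e.target) (y : Coord n) :
    ContMDiffAt 𝓘(ℝ, Coord n × Coord n) (𝓡 n).tangent ∞
      (fun z : Coord n × Coord n => vec e z.1 z.2) (x, y) := by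
  have : IsManifold (𝓡 n) 1 M := IsManifold.of_le (n := ∞) (by simp)
  have h1 := (contMDiffOn_symm_of_mem_maximalAtlas he).contMDiffOn_tangentMapWithin (m := ∞)
    (by simp) e.open_target.uniqueMDiffOn
  have hopen : IsOpen {z : Coord n × Coord n | z.1 ∈ e.target} :=
    e.open_target.preimage continuous_fst
  have h2 := h1.comp (t := _) (s := {z : Coord n × Coord n | z.1 ∈ e.target})
    contMDiff_mk_tangentBundle.contMDiffOn (fun z hz => hz)
  refine ContMDiffOn.contMDiffAt (s := {z : Coord n × Coord n | z.1 ∈ e.target}) ?_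
    (hopen.mem_nhds hx)
  refine h2.congr fun z hz => ?_
  have hmd : MDifferentiableAt (𝓡 n) (𝓡 n) e.symm z.1 :=
    ((contMDiffOn_symm_of_mem_maximalAtlas he).contMDiffAt
      (e.open_target.mem_nhds hz)).mdifferentiableAt (by simp)
  exact (tangentMapWithin_eq_tangentMap (p := (⟨z.1, z.2⟩ : TangentBundle (𝓡 n) (Coord n)))
    (e.open_target.uniqueMDiffOn _ hz) hmd).symm

/-- The components of a tangent vector in the chart `e`. -/
def components (e : OpenPartialHomeomorph M (Coord n)) (x : M) :
    TangentSpace (𝓡 n) x →ₗ[ℝ] Coord n :=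
  (mfderiv (𝓡 n) (𝓡 n) e x).toLinearMap

theorem contMDiffAt_components [IsManifold (𝓡 n) ∞ M]
    (he : e ∈ IsManifold.maximalAtlas (𝓡 n) ∞ M)
    {v : TangentBundle (𝓡 n) M} (hv : v.proj ∈ e.source) :
    ContMDiffAt (𝓡 n).tangent 𝓘(ℝ, Coord n × Coord n) ∞
      (fun v : TangentBundle (𝓡 n) M => (e v.proj, components e v.proj v.snd)) v := by
  have : IsManifold (𝓡 n) 1 M := IsManifold.of_le (n := ∞) (by simp)
  have h1 := (contMDiffOn_of_mem_maximalAtlas he).contMDiffOn_tangentMapWithin (m := ∞)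
    (by simp) e.open_source.uniqueMDiffOn
  have hopen : IsOpen {v : TangentBundle (𝓡 n) M | v.proj ∈ e.source} :=
    e.open_source.preimage (FiberBundle.continuous_proj _ _)
  have h2 := contMDiff_toProd_tangentBundle.comp_contMDiffOn h1
  refine ContMDiffOn.contMDiffAt (s := {v : TangentBundle (𝓡 n) M | v.proj ∈ e.source}) ?_
    (hopen.mem_nhds hv)
  refine h2.congr fun z hz => ?_
  have hmd : MDifferentiableAt (𝓡 n) (𝓡 n) e z.proj :=
    ((contMDiffOn_of_mem_maximalAtlas he).contMDiffAt
      (e.open_source.mem_nhds hz)).mdifferentiableAt (by simp)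
  have h3 := tangentMapWithin_eq_tangentMap (p := z) (e.open_source.uniqueMDiffOn _ hz) hmd
  have h4 : ((fun v : TangentBundle (𝓡 n) (Coord n) => ((v.proj, v.snd) : Coord n × Coord n)) ∘
      tangentMapWithin (𝓡 n) (𝓡 n) e e.source) z
      = (fun v : TangentBundle (𝓡 n) (Coord n) => ((v.proj, v.snd) : Coord n × Coord n))
        (tangentMap (𝓡 n) (𝓡 n) e z) := by rw [Function.comp_apply, h3]
  exact h4.symm

theorem mdifferentiable_of_mem_maximalAtlas (he : e ∈ IsManifold.maximalAtlas (𝓡 n) ∞ M) :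
    e.MDifferentiable (𝓡 n) (𝓡 n) :=
  ⟨(contMDiffOn_of_mem_maximalAtlas he).mdifferentiableOn (by simp),
    (contMDiffOn_symm_of_mem_maximalAtlas he).mdifferentiableOn (by simp)⟩

theorem vec_components (he : e ∈ IsManifold.maximalAtlas (𝓡 n) ∞ M)
    (v : TangentBundle (𝓡 n) M) (hv : v.proj ∈ e.source) :
    vec e (e v.proj) (components e v.proj v.snd) = v := by
  obtain ⟨x, v⟩ := v
  have h1 := (mdifferentiable_of_mem_maximalAtlas he).symm_comp_deriv hv
  have h2 := congrArg (fun L : TangentSpace (𝓡 n) x →L[ℝ] TangentSpace (𝓡 n) x => L v) h1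
  exact Bundle.TotalSpace.ext (e.left_inv hv) (heq_of_eq h2)

theorem components_vec (he : e ∈ IsManifold.maximalAtlas (𝓡 n) ∞ M) {x : Coord n}
    (hx : x ∈ e.target) (y : Coord n) : components e (vec e x y).proj (vec e x y).snd = y := by
  have h1 := (mdifferentiable_of_mem_maximalAtlas he).comp_symm_deriv hx
  exact congrArg (fun L : TangentSpace (𝓡 n) x →L[ℝ] TangentSpace (𝓡 n) x => L y) h1

end FinslerConformal

/-! ### Passage between the manifold and its charts. -/

namespace FinslerConformal

section Transfer

variable {n : ℕ} {M : Type*} [TopologicalSpace M] [ChartedSpace (Coord n) M]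
  {e : OpenPartialHomeomorph M (Coord n)}
  {F : TangentBundle (𝓡 n) M → ℝ} {α : M → ℝ}

theorem vec_snd_ne_zero (he : e ∈ IsManifold.maximalAtlas (𝓡 n) ∞ M) {x : Coord n}
    (hx : x ∈ e.target) {y : Coord n} (hy : y ≠ 0) : (vec e x y).snd ≠ 0 := by
  intro h
  have h1 := components_vec he hx y
  rw [h, map_zero] at h1
  exact hy h1.symm

theorem contDiffAt_inChart_two [IsManifold (𝓡 n) ∞ M]
    (hF : IsFinsler F)
    (he : e ∈ IsManifold.maximalAtlas (𝓡 n) ∞ M) {x : Coord n} (hx : x ∈ e.target) {y : Coord n}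
    (hy : y ≠ 0) : ContDiffAt ℝ 2 (fun z : Coord n × Coord n => inChart F e z.1 z.2) (x, y) := by
  have hopen : IsOpen {z : Coord n × Coord n | z.1 ∈ e.target ∧ z.2 ≠ 0} :=
    (e.open_target.preimage continuous_fst).inter (isOpen_ne.preimage continuous_snd)
  have hvec : ContMDiffOn 𝓘(ℝ, Coord n × Coord n) (𝓡 n).tangent 2
      (fun z : Coord n × Coord n => vec e z.1 z.2) {z | z.1 ∈ e.target ∧ z.2 ≠ 0} := fun z hz =>
    (contMDiffAt_infty.1 (contMDiffAt_vec he hz.1 z.2) 2).contMDiffWithinAt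
  have h1 := hF.contMDiffOn_two.comp hvec fun z hz => vec_snd_ne_zero he hz.1 hz.2
  exact (h1.contMDiffAt (hopen.mem_nhds ⟨hx, hy⟩)).contDiffAt

theorem eventually_contDiffAt_inChart [IsManifold (𝓡 n) ∞ M]
    (he : e ∈ IsManifold.maximalAtlas (𝓡 n) ∞ M) {x : Coord n}
    (hx : x ∈ e.target) {y : Coord n} (hreg : IsRegularVec F (vec e x y)) :
    ∀ᶠ z in 𝓝 (x, y), ContDiffAt ℝ ∞ (fun z : Coord n × Coord n => inChart F e z.1 z.2) z := by
  have h1 := (contMDiffAt_vec he hx y).continuousAt.eventually hreg.2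
  have h2 : ∀ᶠ z : Coord n × Coord n in 𝓝 (x, y), z.1 ∈ e.target :=
    (e.open_target.preimage continuous_fst).mem_nhds hx
  filter_upwards [h1, h2] with z hz1 hz2
  exact (ContMDiffAt.comp z hz1 (contMDiffAt_vec he hz2 z.2)).contDiffAt

theorem contDiffAt_comp_symm (hα : ContMDiff (𝓡 n) 𝓘(ℝ, ℝ) ∞ α)
    (he : e ∈ IsManifold.maximalAtlas (𝓡 n) ∞ M) {x : Coord n} (hx : x ∈ e.target) :
    ContDiffAt ℝ ∞ (fun x' => α (e.symm x')) x :=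
  (ContMDiffAt.comp x hα.contMDiffAt ((contMDiffOn_symm_of_mem_maximalAtlas he).contMDiffAt
    (e.open_target.mem_nhds hx))).contDiffAt

theorem exists_regular_line [IsManifold (𝓡 n) ∞ M]
    (hF : IsFinsler F) (he : e ∈ IsManifold.maximalAtlas (𝓡 n) ∞ M)
    {x : Coord n} (hx : x ∈ e.target) :
    ∃ d : Coord n, ∀ y, y ∉ Submodule.span ℝ {d} → IsRegularVec F (vec e x y) := by
  obtain ⟨d, hd⟩ := hF.regular (e.symm x)
  refine ⟨components e (e.symm x) d, fun y hy => hd _ fun h => hy ?_⟩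
  obtain ⟨t, ht⟩ := Submodule.mem_span_singleton.1 h
  refine Submodule.mem_span_singleton.2 ⟨t, ?_⟩
  have h1 := components_vec he hx y
  rw [← map_smul, ht]
  exact h1

theorem isContractedInvariantAt_inChart [IsManifold (𝓡 n) ∞ M]
    (hF : IsFinsler F) (hα : ContMDiff (𝓡 n) 𝓘(ℝ, ℝ) ∞ α)
    (hP : ContractedBerwaldInvariant F α) (he : e ∈ IsManifold.maximalAtlas (𝓡 n) ∞ M)
    {x : Coord n} (hx : x ∈ e.target) :
    IsContractedInvariantAt (inChart F e) (fun x' => α (e.symm x')) x where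
  nonneg y := hF.nonneg _
  contDiffAt_two y hy := contDiffAt_inChart_two hF he hx hy
  homogeneous y t ht := by
    have h1 := hF.homogeneous (e.symm x)
      ((mfderiv (𝓡 n) (𝓡 n) e.symm x : Coord n →L[ℝ] TangentSpace (𝓡 n) (e.symm x)) y) t ht
    have h2 := (mfderiv (𝓡 n) (𝓡 n) e.symm x).map_smul t y
    simp only [inChart, vec]
    exact (congrArg (fun v : TangentSpace (𝓡 n) (e.symm x) => F ⟨e.symm x, v⟩) h2).trans h1
  posDef y hy := hF.posDef e he x hx y hy
  contDiffAt_factor := contDiffAt_comp_symm hα he hx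
  invariant := by
    obtain ⟨d, hd⟩ := exists_regular_line hF he hx
    refine ⟨d, fun y hy => ⟨(eventually_contDiffAt_inChart he hx (hd y hy)).self_of_nhds,
      fun i j k => ?_⟩⟩
    exact hP e he x hx y (hd y hy) i j k

theorem fderiv_comp_symm_ne_zero (hα : ContMDiff (𝓡 n) 𝓘(ℝ, ℝ) ∞ α)
    (he : e ∈ IsManifold.maximalAtlas (𝓡 n) ∞ M) {p : M} (hpe : p ∈ e.source)
    (hp : mfderiv (𝓡 n) 𝓘(ℝ, ℝ) α p ≠ 0) : fderiv ℝ (fun x' => α (e.symm x')) (e p) ≠ 0 := by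
  intro h
  apply hp
  have h1 : α =ᶠ[𝓝 p] (fun x' => α (e.symm x')) ∘ e := by
    filter_upwards [e.open_source.mem_nhds hpe] with q hq
    simp [e.left_inv hq]
  have h2 : MDifferentiableAt (𝓡 n) 𝓘(ℝ, ℝ) (fun x' => α (e.symm x')) (e p) :=
    ((contDiffAt_comp_symm hα he (e.map_source hpe)).differentiableAt
      (by simp)).mdifferentiableAt
  have h3 := mfderiv_comp p h2 ((mdifferentiable_of_mem_maximalAtlas he).mdifferentiableAt hpe)
  rw [h1.mfderiv_eq, h3, mfderiv_eq_fderiv, h]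
  exact ContinuousLinearMap.zero_comp _

/-- The kernel has dimension at least `n - 1 ≥ 2` and does not fit into a line. This supplies the
regular vector in `ker dα` at which `g` and `ρ` are read off. -/
theorem exists_mem_ker_notMem_span (hn : 3 ≤ n) (η : Coord n →L[ℝ] ℝ) (d : Coord n) :
    ∃ v, η v = 0 ∧ v ∉ Submodule.span ℝ {d} := by
  by_contra! h
  have hle : LinearMap.ker η.toLinearMap ≤ Submodule.span ℝ {d} := fun v hv => h v hv
  have h1 := Submodule.finrank_mono hle
  have h2 : Module.finrank ℝ (Submodule.span ℝ {d}) ≤ 1 :=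
    (finrank_span_le_card ({d} : Set (Coord n))).trans (by simp)
  have h3 := LinearMap.finrank_range_add_finrank_ker η.toLinearMap
  have h4 : Module.finrank ℝ (LinearMap.range η.toLinearMap) ≤ 1 := by
    simpa using Submodule.finrank_le (LinearMap.range η.toLinearMap)
  rw [finrank_euclideanSpace_fin] at h3
  omega

/-- Under the invariance of the contracted mixed curvature, `F` is conformal to a
Finsleroid-Finsler metric near every point where `dα` does not vanish. Positivity of the curvature
of the indicatrix is not needed: the norms in the tangent spaces are compared with stretched
Finsleroids by a maximum principle, and Riemannian metrics are the Finsleroids with `g = 0`. -/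
theorem locallyConformalToFinsleroidAt [IsManifold (𝓡 n) ∞ M]
    (hn : 3 ≤ n) (hF : IsFinsler F)
    (hα : ContMDiff (𝓡 n) 𝓘(ℝ, ℝ) ∞ α) {p : M} (hp : mfderiv (𝓡 n) 𝓘(ℝ, ℝ) α p ≠ 0)
    (hP : ContractedBerwaldInvariant F α) : LocallyConformalToFinsleroidAt F p := by
  set e := chartAt (Coord n) p
  have he : e ∈ IsManifold.maximalAtlas (𝓡 n) ∞ M := IsManifold.chart_mem_maximalAtlas p
  have hpe : p ∈ e.source := mem_chart_source _ p
  have hxe : e p ∈ e.target := e.map_source hpe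
  set a : Coord n → ℝ := fun x' => α (e.symm x')
  have htarget : ∀ᶠ x in 𝓝 (e p), x ∈ e.target := e.open_target.mem_nhds hxe
  have hη₀ : fderiv ℝ a (e p) ≠ 0 := fderiv_comp_symm_ne_zero hα he hpe hp
  have hη : ∀ᶠ x in 𝓝 (e p), fderiv ℝ a x ≠ 0 :=
    (((contDiffAt_comp_symm hα he hxe).fderiv_right (m := 0) (by simp)).continuousAt).eventually
      (isOpen_ne.mem_nhds hη₀)
  obtain ⟨d, hd⟩ := exists_regular_line hF he hxe
  obtain ⟨v₀, hv₀, hv₀d⟩ := exists_mem_ker_notMem_span hn (fderiv ℝ a (e p)) d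
  have hv₀0 : v₀ ≠ 0 := by rintro rfl; exact hv₀d (Submodule.zero_mem _)
  obtain ⟨c, g, ρ, hdata⟩ := exists_smooth_finsleroid_data hn
    (htarget.mono fun x hx => isContractedInvariantAt_inChart hF hα hP he hx) hη hv₀0 hv₀
    (eventually_contDiffAt_inChart he hxe (hd v₀ hv₀d))
  obtain ⟨O, hO, hOopen, hpO⟩ := eventually_nhds_iff.1 hdata
  have hU : IsOpen (e.source ∩ e ⁻¹' O) := e.isOpen_inter_preimage hOopen
  have hchart : ∀ x ∈ e.source ∩ e ⁻¹' O, ContMDiffAt (𝓡 n) (𝓡 n) ∞ e x := fun x hx =>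
    (contMDiffOn_of_mem_maximalAtlas he).contMDiffAt (e.open_source.mem_nhds hx.1)
  have hcomp0 : ∀ x ∈ e.source, ∀ v : TangentSpace (𝓡 n) x, v ≠ 0 → components e x v ≠ 0 := by
    intro x hx v hv h0
    have h1 := (mdifferentiable_of_mem_maximalAtlas he).symm_comp_deriv hx
    have h2 := congrArg (fun L : TangentSpace (𝓡 n) x →L[ℝ] TangentSpace (𝓡 n) x => L v) h1
    apply hv
    refine h2.symm.trans ?_
    have h3 : mfderiv (𝓡 n) (𝓡 n) e x v = 0 := h0
    exact (congrArg (mfderiv (𝓡 n) (𝓡 n) e.symm (e x)) h3).trans (map_zero _)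
  refine ⟨e.source ∩ e ⁻¹' O, hU, ⟨hpe, hpO⟩, fun x => ρ (e x), fun v =>
    finsleroidFun (g (e v.proj)) (fderiv ℝ a (e v.proj) (components e v.proj v.snd))
      (√(matrixForm (c (e v.proj)) (components e v.proj v.snd) (components e v.proj v.snd)
        - fderiv ℝ a (e v.proj) (components e v.proj v.snd) ^ 2)), ?_, ?_, ?_⟩
  · intro x hx
    exact (ContMDiffAt.comp x (hO (e x) hx.2).2.2.1.contMDiffAt (hchart x hx)).contMDiffWithinAt
  · refine ⟨fun x => (matrixForm (c (e x))).compl₁₂ (components e x) (components e x),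
      fun x => (fderiv ℝ a (e x)).toLinearMap ∘ₗ components e x, fun x => g (e x),
      ⟨?_, ?_, ?_⟩, ?_, ?_, ?_, ?_, ?_⟩
    · intro x hx v w
      exact (hO (e x) hx.2).2.2.2.2.1.symm _ _
    · intro x hx v hv
      exact (hO (e x) hx.2).2.2.2.2.1.form_pos (hcomp0 x hx.1 v hv)
    · intro v hv
      have h1 : ContDiffAt ℝ ∞ (fun z : Coord n × Coord n => matrixForm (c z.1) z.2 z.2)
          (e v.proj, components e v.proj v.snd) := by
        refine contDiffAt_matrixForm (fun i j => ?_) contDiffAt_snd contDiffAt_snd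
        exact ((hO (e v.proj) hv.2).1 i j).comp (e v.proj, components e v.proj v.snd)
          contDiffAt_fst
      exact (ContMDiffAt.comp v h1.contMDiffAt (contMDiffAt_components he hv.1)).contMDiffWithinAt
    · intro v hv
      have h1 : ContDiffAt ℝ ∞ (fun z : Coord n × Coord n => fderiv ℝ a z.1 z.2)
          (e v.proj, components e v.proj v.snd) := by
        refine ContDiffAt.clm_apply ?_ contDiffAt_snd
        exact ((hO (e v.proj) hv.2).2.2.2.1.fderiv_right (m := ∞)
          (by exact_mod_cast le_rfl)).comp (e v.proj, components e v.proj v.snd) contDiffAt_fst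
      exact (ContMDiffAt.comp v h1.contMDiffAt (contMDiffAt_components he hv.1)).contMDiffWithinAt
    · intro x hx
      obtain ⟨w, hw, hw1⟩ := (hO (e x) hx.2).2.2.2.2.1.exists_dual_vector
      obtain ⟨u, hu⟩ : ∃ u : TangentSpace (𝓡 n) x, components e x u = w :=
        ((mdifferentiable_of_mem_maximalAtlas he).mfderiv hx.1).surjective w
      refine ⟨u, fun v => ?_, ?_⟩
      · have := hw (components e x v)
        rw [← hu] at this
        exact this
      · rw [← hu] at hw1
        exact hw1
    · intro x hx
      exact (ContMDiffAt.comp x (hO (e x) hx.2).2.1.contMDiffAt (hchart x hx)).contMDiffWithinAt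
    · intro x hx
      exact (hO (e x) hx.2).2.2.2.2.2.1
    · intro v _
      rfl
  · intro v hv
    have h1 := (hO (e v.proj) hv.2).2.2.2.2.2.2 (components e v.proj v.snd)
    rw [inChart, vec_components he v hv.1] at h1
    exact h1

end Transfer

end FinslerConformal

end

theorem theoremB {n : ℕ} (hn : 3 ≤ n) {M : Type*} [TopologicalSpace M]
    [ChartedSpace (FinslerConformal.Coord n) M] [IsManifold (𝓡 n) ∞ M]
    (F : TangentBundle (𝓡 n) M → ℝ) (hF : FinslerConformal.IsFinsler F)
    (α : M → ℝ) (hα : ContMDiff (𝓡 n) 𝓘(ℝ, ℝ) ∞ α)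
    (p : M) (hp : mfderiv (𝓡 n) 𝓘(ℝ, ℝ) α p ≠ 0)
    (hcurv : FinslerConformal.IndicatrixPosCurvAt F p)
    (hP : FinslerConformal.ContractedBerwaldInvariant F α) :
    FinslerConformal.LocallyConformalToFinsleroidAt F p ∨
      FinslerConformal.LocallyRiemannianAt F p := by
  -- For `g = 0` the Finsleroid formula reduces to `√(b² + q²)`, so Riemannian metrics fall under
  -- the first alternative.
  exact Or.inl (FinslerConformal.locallyConformalToFinsleroidAt hn hF hα hp hP)
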